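/- Let $G$ be a real finite-dimensional Lie group with Lie algebra $\mathfrak g$ of left invariant vector fields, let $g$ be a left invariant Riemannian metric on $G$ with Levi-Civita connection $\nabla$, and let $X\in\mathfrak g$. Let $\phi:(-b_0,b_0)\to(0,\infty)$ be smooth with $$\phi(s)-s\phi'(s)+(b^2-s^2)\phi''(s)>0\qquad (|s|\le b<b_0),$$ and suppose that $\|X\|:=\sqrt{g(X,X)}<b_0$. Let $F$ be the left invariant $(\alpha,\beta)$-metric $$F(x,y)=\sqrt{g(y,y)}\;\phi\!\left(\frac{g(X(x),y)}{\sqrt{g(y,y)}}\right)\qquad (y\in T_xG).$$ For a vector field $Y=\xi^i\frac{\partial}{\partial x^i}$ on $G$, let $Y^v=\xi^i\frac{\partial}{\partial y^i}$ and $Y^c=\xi^i\frac{\partial}{\partial x^i}+\frac{\partial \xi^i}{\partial x^j}y^j\frac{\partial}{\partial y^i}$ be its vertical and complete lifts to $TG$. Let $\tilde g$ be the Riemannian metric on $TG$ determined by $\tilde g(Y^c,Z^c)=\tilde g(Y^v,Z^v)=g(Y,Z)$ and $\tilde g(Y^c,Z^v)=0$ for $Y,Z\in\mathfrak g$, and let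 $$F^v(p,\tilde z)=\sqrt{\tilde g(\tilde z,\tilde z)}\;\phi\!\left(\frac{\tilde g(X^v(p),\tilde z)}{\sqrt{\tilde g(\tilde z,\tilde z)}}\right)\qquad (p\in TG,\ \tilde z\in T_p(TG)).$$ A Finsler metric is said to be of Berwald type if in standard local coordinates its spray coefficients $G^i=\frac14 g^{il}\big([F^2]_{x^my^l}y^m-[F^2]_{x^l}\big)$, where $(g^{il})$ is the inverse of $(\frac12[F^2]_{y^iy^l})$, are of the form $G^i=\frac12\Gamma^i_{jk}(x)y^jy^k$. Let $\mathrm{ad}^*_X$ be the adjoint of $\mathrm{ad}_X$ with respect to $g$, that is, $g(\mathrm{ad}^*_XY,Z)=g(Y,[X,Z])$ for all $Y,Z\in\mathfrak g$. Assume that either $X=0$ or $F^v$ is not a Riemannian metric; the latter means, for $X\neq0$, that there are no constants $c_1,c_2$ with $\phi(s)^2=c_1+c_2s^2$ for all $|s|\le\|X\|$. Then: 1. $F^v$ is of Berwald type if and only if $\mathrm{ad}^*_X=\mathrm{ad}_X$ and $\nabla_XY=\frac12[X,Y]$ for every $Y\in\mathfrak g$. 2. If $F$ is of Berwald type, then $F^v$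 is of Berwald type if and only if $X$ lies in the center of $\mathfrak g$. -/

import Mathlib

open scoped Manifold ContDiff

noncomputable section

namespace LiftedFinsler

section Finsler

variable {E : Type*} [NormedAddCommGroup E] [NormedSpace ℝ E]

/-- For a function `L = F²` of the coordinates `x` and the fibre coordinates `y`, the fundamental
tensor `g_{(x,y)}(u,v) = ½ ∂²L/∂s∂t (x, y + s u + t v)` at `s = t = 0`. -/
def fundamentalTensor (L : E → E → ℝ) (x y : E) : E →L[ℝ] E →L[ℝ] ℝ :=
  (1 / 2 : ℝ) • fderiv ℝ (fun y' => fderiv ℝ (L x) y') y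

/-- The covector `[L]_{x^m y^l} y^m - [L]_{x^l}`. -/
def sprayCovector (L : E → E → ℝ) (x y : E) : E →L[ℝ] ℝ :=
  fderiv ℝ (fun x' => fderiv ℝ (L x') y) x y - fderiv ℝ (fun x' => L x' y) x

/-- The spray coefficients `G^i = ¼ g^{il} ([L]_{x^m y^l} y^m - [L]_{x^l})`, `L = F²`, collected
into one vector of the coordinate space. -/
def sprayCoefficients (L : E → E → ℝ) (x y : E) : E :=
  (1 / 4 : ℝ) • (fundamentalTensor L x y).inverse (sprayCovector L x y)

variable {H : Type*} [TopologicalSpace H] (I : ModelWithCorners ℝ E H)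
  {M : Type*} [TopologicalSpace M] [ChartedSpace H M]

/-- The function `F²` in the standard local coordinates `(x, y)` of the tangent bundle that are
induced by the chart of `M` around `x₀`. -/
def energyInChart (F : ∀ x : M, TangentSpace I x → ℝ) (x₀ : M) (x y : E) : ℝ :=
  (F ((extChartAt I x₀).symm x) (mfderiv 𝓘(ℝ, E) I (extChartAt I x₀).symm x y)) ^ 2

/-- A Finsler metric `F` on a manifold (without boundary) is of Berwald type if, in standard local
coordinates, its spray coefficients have the form `G^i = ½ Γ^i_{jk}(x) y^j y^k`. -/
def IsBerwald (F : ∀ x : M, TangentSpace I x → ℝ) : Prop :=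
  ∀ x₀ : M, ∃ Γ : E → E →L[ℝ] E →L[ℝ] E, ∀ x ∈ (extChartAt I x₀).target, ∀ y : E, y ≠ 0 →
    sprayCoefficients (energyInChart I F x₀) x y = (1 / 2 : ℝ) • Γ x y y

/-- The conditions on `φ : (-b₀, b₀) → (0, ∞)` under which `α φ(β/α)` is a Finsler metric as soon
as the length of `β` is less than `b₀`. -/
structure IsAlphaBetaFunction (φ : ℝ → ℝ) (b₀ : ℝ) : Prop where
  contDiffOn : ContDiffOn ℝ ∞ φ (Set.Ioo (-b₀) b₀)
  pos : ∀ s ∈ Set.Ioo (-b₀) b₀, 0 < φ s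
  regular : ∀ s b : ℝ, |s| ≤ b → b < b₀ →
    0 < φ s - s * deriv φ s + (b ^ 2 - s ^ 2) * deriv (deriv φ) s

/-- `F(x, y) = α φ(β/α)`, where `α(x, y) = √(g(y, y))` and `β(x, y) = g(X(x), y)`. -/
def alphaBetaMetric (φ : ℝ → ℝ) (g : ∀ x : M, TangentSpace I x → TangentSpace I x → ℝ)
    (X : ∀ x : M, TangentSpace I x) (x : M) (y : TangentSpace I x) : ℝ :=
  √(g x y y) * φ (g x (X x) y / √(g x y y))

end Finsler

section Lifts

variable {E : Type*} [NormedAddCommGroup E] [NormedSpace ℝ E]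
  {H : Type*} [TopologicalSpace H] (I : ModelWithCorners ℝ E H)
  {M : Type*} [TopologicalSpace M] [ChartedSpace H M] [IsManifold I 1 M]

/-- The vertical lift `X^v = ξ^i ∂/∂y^i` of `X = ξ^i ∂/∂x^i`.

In Mathlib the tangent space of `TM` at `p` is `E × E`, the first factor being the span of the
`∂/∂x^i` and the second one that of the `∂/∂y^i`, for the coordinates `(x^i, y^i)` of `TM` induced
by the preferred chart of `M` at the base point of `p`; in that chart the coordinates of a tangent
vector at the base point are the vector itself. -/
def verticalLift (X : ∀ x : M, TangentSpace I x) (p : TangentBundle I M) :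
    TangentSpace I.tangent p :=
  ((0 : E), (X p.proj : E))

/-- The coordinate expression `(ξ^i)` of a vector field in the preferred chart at `x₀`. -/
def coordField (X : ∀ x : M, TangentSpace I x) (x₀ : M) (u : E) : E :=
  (mfderivWithin 𝓘(ℝ, E) I (extChartAt I x₀).symm (Set.range I) u).inverse
    (X ((extChartAt I x₀).symm u))

/-- The complete lift `X^c = ξ^i ∂/∂x^i + (∂ξ^i/∂x^j) y^j ∂/∂y^i` of `X = ξ^i ∂/∂x^i`, in the
coordinates described at `verticalLift`. -/
def completeLift (X : ∀ x : M, TangentSpace I x) (p : TangentBundle I M) :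
    TangentSpace I.tangent p :=
  ((X p.proj : E),
    (fderivWithin ℝ (coordField I X p.proj) (Set.range I) (extChartAt I p.proj p.proj) p.snd : E))

end Lifts

section LieGroups

variable {E : Type*} [NormedAddCommGroup E] [NormedSpace ℝ E]
  {G : Type*} [TopologicalSpace G] [ChartedSpace E G] [Group G] [LieGroup 𝓘(ℝ, E) ∞ G]

/-- Smooth Riemannian metrics on `G`. -/
abbrev RiemannianMetricOn (E : Type*) [NormedAddCommGroup E] [NormedSpace ℝ E]
    (G : Type*) [TopologicalSpace G] [ChartedSpace E G] [IsManifold 𝓘(ℝ, E) 1 G] :=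
  Bundle.ContMDiffRiemannianMetric 𝓘(ℝ, E) ∞ E (fun x : G => TangentSpace 𝓘(ℝ, E) x)

/-- All left translations of `G` are isometries of `g`. -/
def IsLeftInvariant (g : RiemannianMetricOn E G) : Prop :=
  ∀ (a x : G) (v w : TangentSpace 𝓘(ℝ, E) x),
    g.inner (a * x) (mfderiv 𝓘(ℝ, E) 𝓘(ℝ, E) (a * ·) x v)
      (mfderiv 𝓘(ℝ, E) 𝓘(ℝ, E) (a * ·) x w) = g.inner x v w

/-- The element of the Lie algebra whose left invariant vector field has the value `v` at `x`. -/
def toLieAlgebra (x : G) (v : TangentSpace 𝓘(ℝ, E) x) : GroupLieAlgebra 𝓘(ℝ, E) G :=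
  (mfderiv 𝓘(ℝ, E) 𝓘(ℝ, E) (x * ·) (1 : G)).inverse v

/-- The vector representing a linear functional with respect to `g`. -/
def dualVector (g : RiemannianMetricOn E G) (x : G) (l : TangentSpace 𝓘(ℝ, E) x → ℝ) :
    TangentSpace 𝓘(ℝ, E) x :=
  Classical.epsilon fun w => ∀ z : TangentSpace 𝓘(ℝ, E) x, g.inner x w z = l z

/-- The adjoint `ad*_X` of `ad_X` with respect to `g`: `g(ad*_X Y, Z) = g(Y, [X, Z])`. -/
def adStar (g : RiemannianMetricOn E G) (X Y : GroupLieAlgebra 𝓘(ℝ, E) G) :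
    GroupLieAlgebra 𝓘(ℝ, E) G :=
  dualVector g 1 fun Z : GroupLieAlgebra 𝓘(ℝ, E) G => g.inner 1 Y ⁅X, Z⁆

/-- The derivative at `x`, in the direction of the vector field `X`, of the function `g(Y, Z)`. -/
def derivInner (g : RiemannianMetricOn E G) (X Y Z : ∀ x : G, TangentSpace 𝓘(ℝ, E) x) (x : G) :
    ℝ :=
  mfderiv 𝓘(ℝ, E) 𝓘(ℝ, ℝ) (fun a => g.inner a (Y a) (Z a)) x (X x)

open VectorField in
/-- The right-hand side of Koszul's formula
`2 g(∇_X Y, Z) = X g(Y,Z) + Y g(Z,X) - Z g(X,Y) + g([X,Y],Z) - g([Y,Z],X) + g([Z,X],Y)`. -/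
def koszul (g : RiemannianMetricOn E G) (X Y Z : ∀ x : G, TangentSpace 𝓘(ℝ, E) x) (x : G) : ℝ :=
  derivInner g X Y Z x + derivInner g Y Z X x - derivInner g Z X Y x
    + g.inner x (mlieBracket 𝓘(ℝ, E) X Y x) (Z x)
    - g.inner x (mlieBracket 𝓘(ℝ, E) Y Z x) (X x)
    + g.inner x (mlieBracket 𝓘(ℝ, E) Z X x) (Y x)

/-- The vector field `∇_X Y`, where `∇` is the Levi-Civita connection of `g` and `X`, `Y` are
smooth vector fields on `G`; it is determined by Koszul's formula, which it suffices to test on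
the left invariant vector fields because these span every tangent space. -/
def leviCivita (g : RiemannianMetricOn E G) (X Y : ∀ x : G, TangentSpace 𝓘(ℝ, E) x) (x : G) :
    TangentSpace 𝓘(ℝ, E) x :=
  dualVector g x fun z =>
    (1 / 2 : ℝ) * koszul g X Y (mulInvariantVectorField (toLieAlgebra x z)) x

/-- Every `ζ ∈ T_p(TG)` is `Y^c(p) + Z^v(p)` for unique `Y`, `Z` in the Lie algebra; this is `Y`. -/
def completePart (p : TangentBundle 𝓘(ℝ, E) G) (ζ : TangentSpace 𝓘(ℝ, E).tangent p) :
    GroupLieAlgebra 𝓘(ℝ, E) G :=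
  toLieAlgebra p.proj (ζ : E × E).1

/-- Every `ζ ∈ T_p(TG)` is `Y^c(p) + Z^v(p)` for unique `Y`, `Z` in the Lie algebra; this is `Z`. -/
def verticalPart (p : TangentBundle 𝓘(ℝ, E) G) (ζ : TangentSpace 𝓘(ℝ, E).tangent p) :
    GroupLieAlgebra 𝓘(ℝ, E) G :=
  toLieAlgebra p.proj
    (ζ - completeLift 𝓘(ℝ, E) (mulInvariantVectorField (completePart p ζ)) p : E × E).2

/-- The lifted metric on `TG`: for `X`, `Y` left invariant, `(X^c, Y^c) ↦ g(X, Y)`,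
`(X^v, Y^v) ↦ g(X, Y)` and `(X^c, Y^v) ↦ 0`. -/
def liftedMetric (g : RiemannianMetricOn E G) (p : TangentBundle 𝓘(ℝ, E) G)
    (ζ η : TangentSpace 𝓘(ℝ, E).tangent p) : ℝ :=
  g.inner 1 (completePart p ζ) (completePart p η) + g.inner 1 (verticalPart p ζ) (verticalPart p η)

/-- The `(α, β)`-metric on `G` given by `φ`, `g` and the left invariant vector field `X`. -/
def baseMetric (φ : ℝ → ℝ) (g : RiemannianMetricOn E G) (X : GroupLieAlgebra 𝓘(ℝ, E) G) :
    ∀ x : G, TangentSpace 𝓘(ℝ, E) x → ℝ :=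
  alphaBetaMetric 𝓘(ℝ, E) φ (fun x v w => g.inner x v w) (mulInvariantVectorField X)

/-- The vertical lift `F^v` of the metric `F = baseMetric φ g X`: the `(α, β)`-metric on `TG` given
by `φ`, the lifted Riemannian metric and the vertical lift of `X`. -/
def verticalLiftMetric (φ : ℝ → ℝ) (g : RiemannianMetricOn E G)
    (X : GroupLieAlgebra 𝓘(ℝ, E) G) :
    ∀ p : TangentBundle 𝓘(ℝ, E) G, TangentSpace 𝓘(ℝ, E).tangent p → ℝ :=
  alphaBetaMetric 𝓘(ℝ, E).tangent φ (liftedMetric g)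
    (verticalLift 𝓘(ℝ, E) (mulInvariantVectorField X))

end LieGroups

section LieGroupFacts

variable {E : Type*} [NormedAddCommGroup E] [NormedSpace ℝ E]
  {G : Type*} [TopologicalSpace G] [ChartedSpace E G] [Group G] [LieGroup 𝓘(ℝ, E) ∞ G]

theorem isInvertible_mfderiv_mul_left (x : G) :
    (mfderiv 𝓘(ℝ, E) 𝓘(ℝ, E) (x * ·) (1 : G)).IsInvertible := by
  have hd : ∀ a b : G, MDifferentiableAt 𝓘(ℝ, E) 𝓘(ℝ, E) (a * ·) b := fun a b =>
    (contMDiff_mul_left (I := 𝓘(ℝ, E)) (n := ∞) (a := a)).contMDiffAt.mdifferentiableAt (by simp)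
  have key : ∀ a b : G, (mfderiv 𝓘(ℝ, E) 𝓘(ℝ, E) (a⁻¹ * ·) (a * b)).comp
      (mfderiv 𝓘(ℝ, E) 𝓘(ℝ, E) (a * ·) b) = ContinuousLinearMap.id ℝ _ := by
    intro a b
    rw [← mfderiv_comp (I' := 𝓘(ℝ, E)) b (hd _ _) (hd _ _)]
    have : (a⁻¹ * ·) ∘ (a * ·) = (id : G → G) := by ext y; simp
    rw [this, mfderiv_id]
  have key2 : (mfderiv 𝓘(ℝ, E) 𝓘(ℝ, E) (x * ·) (1 : G)).comp
      (mfderiv 𝓘(ℝ, E) 𝓘(ℝ, E) (x⁻¹ * ·) (x * 1)) = ContinuousLinearMap.id ℝ _ := by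
    have := key x⁻¹ (x * 1)
    rw [inv_inv, inv_mul_cancel_left] at this
    exact this
  exact ContinuousLinearMap.IsInvertible.of_inverse key2 (key x 1)

theorem toLieAlgebra_mulInvariantVectorField (Y : GroupLieAlgebra 𝓘(ℝ, E) G) (x : G) :
    toLieAlgebra x (mulInvariantVectorField Y x) = Y :=
  (isInvertible_mfderiv_mul_left x).inverse_apply_self Y

theorem mulInvariantVectorField_toLieAlgebra (x : G) (v : TangentSpace 𝓘(ℝ, E) x) :
    mulInvariantVectorField (toLieAlgebra x v) x = v := by
  have := (isInvertible_mfderiv_mul_left x).self_apply_inverse (y := (show TangentSpace 𝓘(ℝ, E) (x*1) from v))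
  exact this


theorem completePart_completeLift (Y : GroupLieAlgebra 𝓘(ℝ, E) G) (p : TangentBundle 𝓘(ℝ, E) G) :
    completePart p (completeLift 𝓘(ℝ, E) (mulInvariantVectorField Y) p) = Y :=
  toLieAlgebra_mulInvariantVectorField Y p.proj

theorem verticalPart_completeLift (Y : GroupLieAlgebra 𝓘(ℝ, E) G) (p : TangentBundle 𝓘(ℝ, E) G) :
    verticalPart p (completeLift 𝓘(ℝ, E) (mulInvariantVectorField Y) p) = 0 := by
  unfold verticalPart
  rw [completePart_completeLift, sub_self]
  exact map_zero _

theorem completePart_verticalLift (Z : GroupLieAlgebra 𝓘(ℝ, E) G) (p : TangentBundle 𝓘(ℝ, E) G) :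
    completePart p (verticalLift 𝓘(ℝ, E) (mulInvariantVectorField Z) p) = 0 :=
  map_zero _

theorem completeLift_zero (p : TangentBundle 𝓘(ℝ, E) G) :
    completeLift 𝓘(ℝ, E) (mulInvariantVectorField (0 : GroupLieAlgebra 𝓘(ℝ, E) G)) p = 0 := by
  have h0 : (mulInvariantVectorField (0 : GroupLieAlgebra 𝓘(ℝ, E) G)) = 0 := by
    ext x; exact map_zero _
  have h1 : coordField 𝓘(ℝ, E) (0 : ∀ x : G, TangentSpace 𝓘(ℝ, E) x) p.proj = fun _ => 0 := by
    ext u; exact map_zero _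
  unfold completeLift
  rw [h0, h1]
  simp
  rfl

theorem verticalPart_verticalLift (Z : GroupLieAlgebra 𝓘(ℝ, E) G) (p : TangentBundle 𝓘(ℝ, E) G) :
    verticalPart p (verticalLift 𝓘(ℝ, E) (mulInvariantVectorField Z) p) = Z := by
  unfold verticalPart
  rw [completePart_verticalLift, completeLift_zero, sub_zero]
  exact toLieAlgebra_mulInvariantVectorField Z p.proj

/-- The equations that characterize the lifted metric. -/
theorem liftedMetric_lifts (g : RiemannianMetricOn E G) (Y Z : GroupLieAlgebra 𝓘(ℝ, E) G)
    (p : TangentBundle 𝓘(ℝ, E) G) :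
    liftedMetric g p (completeLift 𝓘(ℝ, E) (mulInvariantVectorField Y) p)
        (completeLift 𝓘(ℝ, E) (mulInvariantVectorField Z) p) = g.inner 1 Y Z ∧
      liftedMetric g p (verticalLift 𝓘(ℝ, E) (mulInvariantVectorField Y) p)
        (verticalLift 𝓘(ℝ, E) (mulInvariantVectorField Z) p) = g.inner 1 Y Z ∧
      liftedMetric g p (completeLift 𝓘(ℝ, E) (mulInvariantVectorField Y) p)
        (verticalLift 𝓘(ℝ, E) (mulInvariantVectorField Z) p) = 0 := by
  simp only [liftedMetric, completePart_completeLift, verticalPart_completeLift,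
    completePart_verticalLift, verticalPart_verticalLift, map_zero, add_zero, zero_add,
    zero_apply, and_self]

theorem completeLift_add_verticalLift (p : TangentBundle 𝓘(ℝ, E) G) (ζ : TangentSpace 𝓘(ℝ, E).tangent p) :
    completeLift 𝓘(ℝ, E) (mulInvariantVectorField (completePart p ζ)) p +
      verticalLift 𝓘(ℝ, E) (mulInvariantVectorField (verticalPart p ζ)) p = ζ := by
  have h1 := mulInvariantVectorField_toLieAlgebra p.proj (ζ : E × E).1
  have h2 := mulInvariantVectorField_toLieAlgebra p.proj
    (ζ - completeLift 𝓘(ℝ, E) (mulInvariantVectorField (completePart p ζ)) p : E × E).2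
  refine Prod.ext ?_ ?_
  · refine (add_zero _).trans h1
  · refine (congrArg (fun t : E => (completeLift 𝓘(ℝ, E) (mulInvariantVectorField (completePart p ζ)) p : E × E).2 + t) h2).trans ?_
    exact add_sub_cancel _ _

theorem dualVector_spec [FiniteDimensional ℝ E] (g : RiemannianMetricOn E G) (x : G)
    (l : TangentSpace 𝓘(ℝ, E) x →ₗ[ℝ] ℝ) (z : TangentSpace 𝓘(ℝ, E) x) :
    g.inner x (dualVector g x l) z = l z := by
  have : FiniteDimensional ℝ (TangentSpace 𝓘(ℝ, E) x) := inferInstanceAs (FiniteDimensional ℝ E)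
  let B : TangentSpace 𝓘(ℝ, E) x →ₗ[ℝ] Module.Dual ℝ (TangentSpace 𝓘(ℝ, E) x) :=
    { toFun := fun w => (g.inner x w : TangentSpace 𝓘(ℝ, E) x →ₗ[ℝ] ℝ)
      map_add' := by intro a b; ext; simp
      map_smul' := by intro a b; ext; simp }
  have hB : Function.Injective B := by
    rw [injective_iff_map_eq_zero]
    intro v hv
    by_contra h
    have := g.pos x v h
    have h2 : B v v = 0 := by rw [hv]; rfl
    exact this.ne' h2
  have hs : Function.Surjective B :=
    (LinearMap.injective_iff_surjective_of_finrank_eq_finrank Subspace.dual_finrank_eq.symm).1 hB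
  obtain ⟨w, hw⟩ := hs l
  have hex : ∃ w, ∀ z, g.inner x w z = l z := ⟨w, fun z => by rw [← hw]; rfl⟩
  exact Classical.epsilon_spec hex z

end LieGroupFacts

end LiftedFinsler

end

open scoped Manifold ContDiff Topology Bundle
open VectorField

noncomputable section

namespace LiftedFinsler

/-! ### Quadratic sprays and connections preserving the energy -/

section Spray

variable {V : Type*} [NormedAddCommGroup V] [NormedSpace ℝ V]

/-! A spray is quadratic exactly when some torsion free linear connection preserves `L = F²`
(`sprayCoefficients_eq_iff`). In the frame of left invariant fields on `G`, and in the frame of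
their complete and vertical lifts on `TG`, the metrics `F` and `F^v` are the same Minkowski norm at
every point. Berwald type thus becomes pointwise algebra (`exists_sprayCoefficients_eq_iff`): there
must be a bilinear `T` whose antisymmetrization is the bracket `c` of the frame and which satisfies
`dN_η(T(w, η)) = 0` for the energy `N`.

The decisive point is `isotropy_alphaBetaEnergy`: a linear field preserving a non-Riemannian `(α,
β)`-norm preserves `α` and `β` separately. So `T` is a torsion free metric connection for which `X`
is parallel. In terms of the bracket, `β` is closed, `B(X, c(w, η)) = 0`, and `X` is Killing, `c(X,
·)` being skew for `B`. Conversely, under these two conditions the Levi-Civita connection of `α`,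
given by Koszul's formula, preserves `α` and `β`.

On `TG` the brackets are `[Y^c, Z^c] = [Y, Z]^c`, `[Y^c, Z^v] = [Y, Z]^v` and `[Y^v, Z^v] = 0`
(`prolongFrame_bracket`). For `X^v` closedness reads `g(X, [Y, Z]) = 0`. The Killing equation,
tested on a complete and a vertical lift, reads `g([X, Y], Z) = 0`: skewness becomes centrality
because the two arguments lie in orthogonal summands.

It remains to match this with the stated conditions. If `ad_X` is self-adjoint and `∇_X Y = ½[X,
Y]`, Koszul's formula equates the expression `g([Y, Z], X)`, antisymmetric in `Y` and `Z`, with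
`-g([X, Z], Y)`, which is symmetric; both vanish. For the second claim, `F` of Berwald type already
gives the closedness condition, so only centrality is left. -/

theorem fderiv_apply_self_of_homogeneous {f : V → ℝ} {y : V} (hf : DifferentiableAt ℝ f y)
    (hh : ∀ t : ℝ, 0 < t → f (t • y) = t ^ 2 * f y) : fderiv ℝ f y y = 2 * f y := by
  have h1 : HasDerivAt (fun t : ℝ => f (t • y)) (fderiv ℝ f y y) 1 := by
    have h2 : HasDerivAt (fun t : ℝ => t • y) y 1 := by
      simpa using (hasDerivAt_id (1 : ℝ)).smul_const y
    have h3 : HasFDerivAt f (fderiv ℝ f y) ((1 : ℝ) • y) := by simpa using hf.hasFDerivAt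
    exact h3.comp_hasDerivAt 1 h2
  have h2 : HasDerivAt (fun t : ℝ => t ^ 2 * f y) (2 * f y) 1 := by
    simpa using (hasDerivAt_pow 2 (1 : ℝ)).mul_const (f y)
  refine h1.unique (h2.congr_of_eventuallyEq ?_)
  filter_upwards [lt_mem_nhds (zero_lt_one (α := ℝ))] with t ht using hh t ht

variable {L : V → V → ℝ} {x y : V}

theorem fderiv_right_eq (h : DifferentiableAt ℝ (Function.uncurry L) (x, y)) :
    fderiv ℝ (L x) y = (fderiv ℝ (Function.uncurry L) (x, y)).comp (.inr ℝ V V) :=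
  (h.hasFDerivAt.comp y (hasFDerivAt_prodMk_right x y)).fderiv

theorem fderiv_left_eq (h : DifferentiableAt ℝ (Function.uncurry L) (x, y)) :
    fderiv ℝ (fun x' => L x' y) x = (fderiv ℝ (Function.uncurry L) (x, y)).comp (.inl ℝ V V) :=
  (HasFDerivAt.comp (f := fun x' => (x', y)) x h.hasFDerivAt (hasFDerivAt_prodMk_left x y)).fderiv

theorem eventually_differentiableAt_of_contDiffAt_two {f : V × V → ℝ} {p : V × V}
    (h : ContDiffAt ℝ 2 f p) : ∀ᶠ q in 𝓝 p, DifferentiableAt ℝ f q := by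
  filter_upwards [h.eventually (by simp)] with q hq using hq.differentiableAt (by simp)

theorem differentiableAt_fderiv_of_contDiffAt_two {f : V × V → ℝ} {p : V × V}
    (h : ContDiffAt ℝ 2 f p) : DifferentiableAt ℝ (fderiv ℝ f) p :=
  (h.fderiv_right (m := 1) (by norm_num)).differentiableAt (by simp)

/-- Iterated partial derivatives are read off as components of one second derivative of
`Function.uncurry L`, so that its symmetry can be used for the mixed ones. -/
theorem hasFDerivAt_fderiv_right_snd (h : ContDiffAt ℝ 2 (Function.uncurry L) (x, y)) (w : V) :
    HasFDerivAt (fun y' => fderiv ℝ (L x) y' w)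
      (((fderiv ℝ (fderiv ℝ (Function.uncurry L)) (x, y)).comp (.inr ℝ V V)).flip (0, w)) y := by
  have h1 := ((differentiableAt_fderiv_of_contDiffAt_two h).hasFDerivAt.comp y
    (hasFDerivAt_prodMk_right x y)).clm_apply (hasFDerivAt_const ((0 : V), w) y)
  refine HasFDerivAt.congr_of_eventuallyEq (f := fun y' => fderiv ℝ (Function.uncurry L) (x, y') (0, w)) ?_ ?_
  · exact h1.congr_fderiv (by ext; simp)
  · have : Filter.Tendsto (fun y' => (x, y')) (𝓝 y) (𝓝 (x, y)) := by
      exact (Continuous.prodMk_right x).tendsto y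
    filter_upwards [this.eventually (eventually_differentiableAt_of_contDiffAt_two h)] with y' hy'
    rw [fderiv_right_eq hy']; simp

theorem hasFDerivAt_fderiv_right_fst (h : ContDiffAt ℝ 2 (Function.uncurry L) (x, y)) (w : V) :
    HasFDerivAt (fun x' => fderiv ℝ (L x') y w)
      (((fderiv ℝ (fderiv ℝ (Function.uncurry L)) (x, y)).comp (.inl ℝ V V)).flip (0, w)) x := by
  have h1 := (HasFDerivAt.comp (f := fun x' => (x', y)) x
    (differentiableAt_fderiv_of_contDiffAt_two h).hasFDerivAt (hasFDerivAt_prodMk_left x y)).clm_apply (hasFDerivAt_const ((0 : V), w) x)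
  refine HasFDerivAt.congr_of_eventuallyEq (f := fun x' => fderiv ℝ (Function.uncurry L) (x', y) (0, w)) ?_ ?_
  · exact h1.congr_fderiv (by ext; simp)
  · have : Filter.Tendsto (fun x' => (x', y)) (𝓝 x) (𝓝 (x, y)) := by
      exact (Continuous.prodMk_left y).tendsto x
    filter_upwards [this.eventually (eventually_differentiableAt_of_contDiffAt_two h)] with y' hy'
    rw [fderiv_right_eq hy']; simp

theorem hasFDerivAt_fderiv_left_snd (h : ContDiffAt ℝ 2 (Function.uncurry L) (x, y)) (u : V) :
    HasFDerivAt (fun y' => fderiv ℝ (fun x' => L x' y') x u)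
      (((fderiv ℝ (fderiv ℝ (Function.uncurry L)) (x, y)).comp (.inr ℝ V V)).flip (u, 0)) y := by
  have h1 := ((differentiableAt_fderiv_of_contDiffAt_two h).hasFDerivAt.comp y
    (hasFDerivAt_prodMk_right x y)).clm_apply (hasFDerivAt_const (u, (0 : V)) y)
  refine HasFDerivAt.congr_of_eventuallyEq (f := fun y' => fderiv ℝ (Function.uncurry L) (x, y') (u, 0)) ?_ ?_
  · exact h1.congr_fderiv (by ext; simp)
  · have : Filter.Tendsto (fun y' => (x, y')) (𝓝 y) (𝓝 (x, y)) := by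
      exact (Continuous.prodMk_right x).tendsto y
    filter_upwards [this.eventually (eventually_differentiableAt_of_contDiffAt_two h)] with y' hy'
    rw [fderiv_left_eq hy']; simp

theorem hasFDerivAt_fderiv_right_snd' (h : ContDiffAt ℝ 2 (Function.uncurry L) (x, y)) :
    HasFDerivAt (fun y' => fderiv ℝ (L x) y')
      (fderiv ℝ (fun y' => fderiv ℝ (L x) y') y) y := by
  have h1 : ContDiffAt ℝ 2 (L x) y := h.comp y (contDiffAt_const.prodMk contDiffAt_id)
  exact ((h1.fderiv_right (m := 1) (by norm_num)).differentiableAt (by simp)).hasFDerivAt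

theorem fderiv_fderiv_right_snd (h : ContDiffAt ℝ 2 (Function.uncurry L) (x, y)) (v w : V) :
    fderiv ℝ (fun y' => fderiv ℝ (L x) y') y v w =
      fderiv ℝ (fderiv ℝ (Function.uncurry L)) (x, y) (0, v) (0, w) := by
  have h1 := (hasFDerivAt_fderiv_right_snd' h).clm_apply (hasFDerivAt_const w y)
  have := DFunLike.congr_fun (h1.unique (hasFDerivAt_fderiv_right_snd h w)) v
  simpa using this

theorem fderiv_fderiv_right_fst (h : ContDiffAt ℝ 2 (Function.uncurry L) (x, y)) (u w : V) :
    fderiv ℝ (fun x' => fderiv ℝ (L x') y) x u w =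
      fderiv ℝ (fderiv ℝ (Function.uncurry L)) (x, y) (u, 0) (0, w) := by
  have h0 : DifferentiableAt ℝ (fun x' => fderiv ℝ (L x') y) x := by
    have h1 := (DifferentiableAt.comp (f := fun x' => (x', y)) x
      (differentiableAt_fderiv_of_contDiffAt_two h) (hasFDerivAt_prodMk_left x y).differentiableAt).clm_comp
        (differentiableAt_const (ContinuousLinearMap.inr ℝ V V))
    refine h1.congr_of_eventuallyEq ?_
    have : Filter.Tendsto (fun x' => (x', y)) (𝓝 x) (𝓝 (x, y)) := by
      exact (Continuous.prodMk_left y).tendsto x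
    filter_upwards [this.eventually (eventually_differentiableAt_of_contDiffAt_two h)] with y' hy'
    exact fderiv_right_eq hy'
  have h1 := h0.hasFDerivAt.clm_apply (hasFDerivAt_const w x)
  have := DFunLike.congr_fun (h1.unique (hasFDerivAt_fderiv_right_fst h w)) u
  simpa using this

/-- The quadratic vector field `½ Γ(y, y)` consists of the spray coefficients of `L` at `x` if and
only if the linear connection `Γ` preserves `L` at `x`. -/
theorem sprayCoefficients_eq_iff [FiniteDimensional ℝ V]
    (hC : ∀ y, y ≠ 0 → ContDiffAt ℝ 2 (Function.uncurry L) (x, y))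
    (hh : ∀ᶠ x' in 𝓝 x, ∀ t : ℝ, 0 < t → ∀ y, L x' (t • y) = t ^ 2 * L x' y)
    (hpos : ∀ y, y ≠ 0 → ∀ v, v ≠ 0 → 0 < fderiv ℝ (fun y' => fderiv ℝ (L x) y') y v v)
    (Γ : V →L[ℝ] V →L[ℝ] V) (hΓ : ∀ u v, Γ u v = Γ v u) :
    (∀ y, y ≠ 0 → sprayCoefficients L x y = (1 / 2 : ℝ) • Γ y y) ↔
      ∀ y, y ≠ 0 → ∀ u, fderiv ℝ (fun x' => L x' y) x u = fderiv ℝ (L x) y (Γ u y) := by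
  have hsymm : ∀ y, y ≠ 0 → IsSymmSndFDerivAt ℝ (Function.uncurry L) (x, y) := fun y hy =>
    (hC y hy).isSymmSndFDerivAt (by simp)
  have hHsymm : ∀ y, y ≠ 0 → ∀ v w, fderiv ℝ (fun y' => fderiv ℝ (L x) y') y v w =
      fderiv ℝ (fun y' => fderiv ℝ (L x) y') y w v := by
    intro y hy v w
    rw [fderiv_fderiv_right_snd (hC y hy), fderiv_fderiv_right_snd (hC y hy)]
    exact hsymm y hy _ _
  have hne : ∀ y : V, y ≠ 0 → ∀ᶠ y' in 𝓝 y, y' ≠ 0 := fun y hy => isOpen_ne.mem_nhds hy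
  have hd : ∀ y, y ≠ 0 → DifferentiableAt ℝ (Function.uncurry L) (x, y) := fun y hy =>
    (hC y hy).differentiableAt (by simp)
  have hd2 : ∀ y, y ≠ 0 → DifferentiableAt ℝ (L x) y := fun y hy =>
    DifferentiableAt.comp (f := fun y' => (x, y')) y (hd y hy) (hasFDerivAt_prodMk_right x y).differentiableAt
  have hE : ∀ y, y ≠ 0 → fderiv ℝ (L x) y y = 2 * L x y := fun y hy =>
    fderiv_apply_self_of_homogeneous (hd2 y hy) (fun t ht => hh.self_of_nhds t ht y)
  -- Euler's relation for the vertical derivative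
  have hH : ∀ y, y ≠ 0 → ∀ v, fderiv ℝ (fun y' => fderiv ℝ (L x) y') y v y =
      fderiv ℝ (L x) y v := by
    intro y hy v
    have h1 := (hasFDerivAt_fderiv_right_snd' (hC y hy)).clm_apply (hasFDerivAt_id y)
    have h2 := ((hd2 y hy).hasFDerivAt.const_mul 2).congr_of_eventuallyEq
      (show (fun y' => fderiv ℝ (L x) y' (id y')) =ᶠ[𝓝 y] fun y' => 2 * L x y' from
        (hne y hy).mono fun y' hy' => hE y' hy')
    have := DFunLike.congr_fun (h1.unique h2) v
    simp at this
    linarith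
  have hH' : ∀ y, y ≠ 0 → ∀ v, fderiv ℝ (fun y' => fderiv ℝ (L x) y') y y v =
      fderiv ℝ (L x) y v := fun y hy v => by rw [hHsymm y hy, hH y hy]
  have hM : ∀ y, y ≠ 0 → ∀ u, fderiv ℝ (fun x' => fderiv ℝ (L x') y) x u y =
      2 * fderiv ℝ (fun x' => L x' y) x u := by
    intro y hy u
    have h1 := hasFDerivAt_fderiv_right_fst (hC y hy) y
    have hdl : DifferentiableAt ℝ (fun x' => L x' y) x :=
      DifferentiableAt.comp (f := fun x' => (x', y)) x (hd y hy) (hasFDerivAt_prodMk_left x y).differentiableAt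
    have htend : Filter.Tendsto (fun x' => (x', y)) (𝓝 x) (𝓝 (x, y)) :=
      (Continuous.prodMk_left y).tendsto x
    have h2 := (hdl.hasFDerivAt.const_mul 2).congr_of_eventuallyEq
      (show (fun x' => fderiv ℝ (L x') y y) =ᶠ[𝓝 x] fun x' => 2 * L x' y by
        filter_upwards [hh, htend.eventually
          (eventually_differentiableAt_of_contDiffAt_two (hC y hy))] with x' h h'
        exact fderiv_apply_self_of_homogeneous (DifferentiableAt.comp (f := fun y' => (x', y')) y h'
          (hasFDerivAt_prodMk_right x' y).differentiableAt) (fun t ht => h t ht y))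
    have := DFunLike.congr_fun (h1.unique h2) u
    rw [fderiv_fderiv_right_fst (hC y hy)]
    simpa using this
  have hK : ∀ y, y ≠ 0 → ∀ v u, fderiv ℝ (fderiv ℝ (Function.uncurry L)) (x, y) (0, v) (u, 0) =
      fderiv ℝ (fun x' => fderiv ℝ (L x') y) x u v := by
    intro y hy v u
    rw [fderiv_fderiv_right_fst (hC y hy)]
    exact hsymm y hy _ _
  have hP : ∀ y, y ≠ 0 → ∀ c, HasFDerivAt (fun y' => fderiv ℝ (L x) y' (Γ c y'))
      ((fderiv ℝ (L x) y).comp (Γ c) + (fderiv ℝ (fun y' => fderiv ℝ (L x) y') y).flip (Γ c y)) y :=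
    fun y hy c => (hasFDerivAt_fderiv_right_snd' (hC y hy)).clm_apply (Γ c).hasFDerivAt
  -- the spray equation
  have hspray : ∀ y, y ≠ 0 → (sprayCoefficients L x y = (1 / 2 : ℝ) • Γ y y ↔
      sprayCovector L x y = fderiv ℝ (fun y' => fderiv ℝ (L x) y') y (Γ y y)) := by
    intro y hy
    have hinv : (fundamentalTensor L x y).IsInvertible := by
      have hinj : Function.Injective (fundamentalTensor L x y) := by
        rw [injective_iff_map_eq_zero]
        intro v hv
        by_contra h
        have h1 := hpos y hy v h
        have h2 : fundamentalTensor L x y v v = 0 := by rw [hv]; rfl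
        simp [fundamentalTensor] at h2
        exact h1.ne' h2
      have hfr : Module.finrank ℝ V = Module.finrank ℝ (V →L[ℝ] ℝ) := by
        rw [(LinearMap.toContinuousLinearMap (𝕜 := ℝ) (E := V) (F' := ℝ)).symm.finrank_eq]
        exact Subspace.dual_finrank_eq.symm
      refine ⟨(LinearEquiv.ofInjectiveOfFinrankEq (fundamentalTensor L x y).toLinearMap hinj hfr).toContinuousLinearEquiv, ?_⟩
      ext; rfl
    have hc : sprayCoefficients L x y = (1 / 2 : ℝ) • Γ y y ↔
        (fundamentalTensor L x y).inverse (sprayCovector L x y) = (2 : ℝ) • Γ y y := by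
      unfold sprayCoefficients
      constructor
      · intro h
        have := congrArg (fun z => (4 : ℝ) • z) h
        simp only [smul_smul] at this
        norm_num at this
        exact this
      · intro h
        rw [h, smul_smul]; norm_num
    rw [hc]
    constructor
    · intro h
      have := congrArg (fundamentalTensor L x y) h
      rw [hinv.self_apply_inverse] at this
      rw [this]
      simp [fundamentalTensor]
    · intro h
      have h2 : sprayCovector L x y = fundamentalTensor L x y ((2 : ℝ) • Γ y y) := by
        rw [h]; simp [fundamentalTensor]
      rw [h2, hinv.inverse_apply_self]
  constructor
  · intro h
    have h1 : ∀ y, y ≠ 0 → ∀ v, fderiv ℝ (fun x' => fderiv ℝ (L x') y) x y v -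
        fderiv ℝ (fun x' => L x' y) x v = fderiv ℝ (fun y' => fderiv ℝ (L x) y') y (Γ y y) v := by
      intro y hy v
      rw [← (hspray y hy).1 (h y hy)]; rfl
    -- Pair the spray equation with `y`; Euler's relations `hM` and `hH` lower the order of the
    -- derivatives.
    have h2 : ∀ y, y ≠ 0 → fderiv ℝ (fun x' => L x' y) x y = fderiv ℝ (L x) y (Γ y y) := by
      intro y hy
      have := h1 y hy y
      rw [hM y hy, hH y hy] at this
      linarith
    intro y hy u
    have hdl : ∀ᶠ y' in 𝓝 y, fderiv ℝ (fun x' => L x' y') x y' =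
        fderiv ℝ (Function.uncurry L) (x, y') (y', 0) := by
      filter_upwards [hne y hy] with y' hy'
      rw [fderiv_left_eq (hd y' hy')]; simp
    have hD : HasFDerivAt (fun y' => fderiv ℝ (Function.uncurry L) (x, y') (y', 0)) _ y :=
      ((differentiableAt_fderiv_of_contDiffAt_two (hC y hy)).hasFDerivAt.comp y
        (hasFDerivAt_prodMk_right x y)).clm_apply (hasFDerivAt_prodMk_left y 0)
    have hPP : HasFDerivAt (fun y' => fderiv ℝ (L x) y' (Γ y' y')) _ y :=
      (hasFDerivAt_fderiv_right_snd' (hC y hy)).clm_apply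
        (Γ.hasFDerivAt.clm_apply (hasFDerivAt_id y))
    have h3 := hD.congr_of_eventuallyEq (hdl.mono fun y' h' => h')
    have h4 := h3.congr_of_eventuallyEq
      (show (fun y' => fderiv ℝ (L x) y' (Γ y' y')) =ᶠ[𝓝 y] _ from
        (hne y hy).mono fun y' hy' => (h2 y' hy').symm)
    -- Differentiate `h2` in `y` along `u`. Subtracting the spray equation at `u` leaves twice the
    -- desired identity, since `Γ u y = Γ y u`.
    have h5 := DFunLike.congr_fun (hPP.unique h4) u
    simp at h5
    have h6 := h1 y hy u
    have h7 := hK y hy u y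
    have h8 : fderiv ℝ (fun x' => L x' y) x u =
        fderiv ℝ (Function.uncurry L) (x, y) (u, 0) := by
      rw [fderiv_left_eq (hd y hy)]; simp
    have h9 := hHsymm y hy (Γ y y) u
    have h10 := hΓ y u
    rw [h10] at h5
    linarith
  · intro h y hy
    rw [hspray y hy]
    ext v
    -- Differentiate the compatibility in `y` along `v`, with `u` fixed. At `u = y`, subtracting the
    -- compatibility at `v` gives the spray equation.
    have h1 : ∀ u, fderiv ℝ (fderiv ℝ (Function.uncurry L)) (x, y) (0, v) (u, 0) =
        fderiv ℝ (L x) y (Γ u v) + fderiv ℝ (fun y' => fderiv ℝ (L x) y') y v (Γ u y) := by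
      intro u
      have h2 := (hasFDerivAt_fderiv_left_snd (hC y hy) u).unique ((hP y hy u).congr_of_eventuallyEq
        ((hne y hy).mono fun y' hy' => h y' hy' u))
      simpa using DFunLike.congr_fun h2 v
    have h2 := h1 y
    rw [hK y hy] at h2
    have h3 : sprayCovector L x y v = fderiv ℝ (fun x' => fderiv ℝ (L x') y) x y v -
      fderiv ℝ (fun x' => L x' y) x v := rfl
    rw [h3, h2, h y hy v, hΓ y v, hHsymm y hy]
    ring

end Spray

/-! ### Frames in which the metric has constant coefficients -/

section Frames

variable {V : Type*} [NormedAddCommGroup V] [NormedSpace ℝ V]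
  {W : Type*} [NormedAddCommGroup W] [NormedSpace ℝ W]

/-- A positively `2`-homogeneous function, twice differentiable away from the origin with positive
definite Hessian there: the square of a Minkowski norm. -/
structure IsMinkowskiEnergy (N : W → ℝ) : Prop where
  contDiffAt : ∀ η, η ≠ 0 → ContDiffAt ℝ 2 N η
  homogeneous : ∀ t : ℝ, 0 < t → ∀ η, N (t • η) = t ^ 2 * N η
  hessian_pos : ∀ η, η ≠ 0 → ∀ v, v ≠ 0 → 0 < fderiv ℝ (fderiv ℝ N) η v v

theorem IsMinkowskiEnergy.hessian_comp_pos {N : W → ℝ} (hN : IsMinkowskiEnergy N) (θ : V ≃L[ℝ] W)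
    {f : V → ℝ} (hf : ∀ y, f y = N (θ y)) {y : V} (hy : y ≠ 0) {v : V} (hv : v ≠ 0) :
    0 < fderiv ℝ (fderiv ℝ f) y v v := by
  obtain rfl : f = fun y => N (θ y) := funext hf
  have h0 : ∀ y : V, y ≠ 0 → θ y ≠ 0 := fun y hy h => hy (θ.map_eq_zero_iff.1 h)
  have h1 : ∀ y, y ≠ 0 → fderiv ℝ (fun y => N (θ y)) y = (fderiv ℝ N (θ y)).comp (θ : V →L[ℝ] W) :=
    fun y hy => (HasFDerivAt.comp y ((hN.contDiffAt _ (h0 y hy)).differentiableAt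
      (by simp)).hasFDerivAt θ.hasFDerivAt).fderiv
  have h2 : HasFDerivAt (fderiv ℝ N) (fderiv ℝ (fderiv ℝ N) (θ y)) (θ y) :=
    (((hN.contDiffAt _ (h0 y hy)).fderiv_right (m := 1) (by norm_num)).differentiableAt
      (by simp)).hasFDerivAt
  have h3 : HasFDerivAt (fun y => (fderiv ℝ N (θ y)).comp (θ : V →L[ℝ] W)) _ y :=
    (HasFDerivAt.comp y h2 θ.hasFDerivAt).clm_comp (hasFDerivAt_const (θ : V →L[ℝ] W) y)
  have h4 : fderiv ℝ (fun y => N (θ y)) =ᶠ[𝓝 y] fun y => (fderiv ℝ N (θ y)).comp (θ : V →L[ℝ] W) :=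
    by
    filter_upwards [isOpen_ne.mem_nhds hy] with y' hy' using h1 y' hy'
  rw [(h3.congr_of_eventuallyEq h4).fderiv]
  simpa using hN.hessian_pos _ (h0 y hy) _ (h0 v hv)

variable [CompleteSpace W] {L : V → V → ℝ} {N : W → ℝ} {e : V → W →L[ℝ] V} {x : V}

theorem contDiffAt_inverse_of_isInvertible (he : ContDiffAt ℝ 2 e x) (hinv : (e x).IsInvertible) :
    ContDiffAt ℝ 2 (fun x' => (e x').inverse) x := by
  obtain ⟨e₀, he₀⟩ := hinv
  have := contDiffAt_map_inverse (n := 2) e₀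
  rw [he₀] at this
  exact this.comp x he

theorem eventually_isInvertible (he : ContinuousAt e x) (hinv : (e x).IsInvertible) :
    ∀ᶠ x' in 𝓝 x, (e x').IsInvertible := by
  obtain ⟨e₀, he₀⟩ := hinv
  have := ContinuousLinearEquiv.nhds e₀
  rw [he₀] at this
  exact he this

/-- In a frame in which `L` has constant coefficients, the spray coefficients of `L` are quadratic
if and only if some torsion free connection is compatible with `N`. -/
theorem exists_sprayCoefficients_eq_iff [FiniteDimensional ℝ V] (hN : IsMinkowskiEnergy N) (he : ContDiffAt ℝ 2 e x)
    (hinv : (e x).IsInvertible) (hL : ∀ᶠ x' in 𝓝 x, ∀ η, L x' (e x' η) = N η) :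
    (∃ Γ : V →L[ℝ] V →L[ℝ] V, ∀ y, y ≠ 0 → sprayCoefficients L x y = (1 / 2 : ℝ) • Γ y y) ↔
      ∃ T : W →L[ℝ] W →L[ℝ] W,
        (∀ w η, e x (T w η - T η w) = fderiv ℝ e x (e x w) η - fderiv ℝ e x (e x η) w) ∧
        ∀ w η, η ≠ 0 → fderiv ℝ N η (T w η) = 0 := by
  have hei : ∀ᶠ x' in 𝓝 x, (e x').IsInvertible := eventually_isInvertible he.continuousAt hinv
  have hL2 : ∀ᶠ x' in 𝓝 x, ∀ y, L x' y = N ((e x').inverse y) := by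
    filter_upwards [hL, hei] with x' h1 h2 y
    rw [← h1, h2.self_apply_inverse]
  have hθC := contDiffAt_inverse_of_isInvertible he hinv
  set θ := (e x).inverse with hθ
  have heθ : ∀ v, e x (θ v) = v := fun v => hinv.self_apply_inverse v
  have hθe : ∀ w, θ (e x w) = w := fun w => hinv.inverse_apply_self w
  have hθ0 : ∀ y, y ≠ 0 → θ y ≠ 0 := by
    intro y hy h
    apply hy; rw [← heθ y, h, map_zero]
  have hC : ∀ y, y ≠ 0 → ContDiffAt ℝ 2 (Function.uncurry L) (x, y) := by
    intro y hy
    have h1 : ContDiffAt ℝ 2 (fun p : V × V => N ((e p.1).inverse p.2)) (x, y) := by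
      refine ContDiffAt.comp (g := N) (f := fun p : V × V => (e p.1).inverse p.2) (x, y)
        (hN.contDiffAt _ (hθ0 y hy)) ?_
      exact (hθC.comp (x, y) contDiffAt_fst).clm_apply contDiffAt_snd
    refine h1.congr_of_eventuallyEq ?_
    have : ∀ᶠ p : V × V in 𝓝 (x, y), ∀ y, L p.1 y = N ((e p.1).inverse y) :=
      (continuous_fst.tendsto (x, y)).eventually hL2
    exact this.mono fun p hp => hp p.2
  have hh : ∀ᶠ x' in 𝓝 x, ∀ t : ℝ, 0 < t → ∀ y, L x' (t • y) = t ^ 2 * L x' y := by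
    filter_upwards [hL2] with x' h t ht y
    rw [h, h, map_smul, hN.homogeneous t ht]
  have hpos : ∀ y, y ≠ 0 → ∀ v, v ≠ 0 → 0 < fderiv ℝ (fun y' => fderiv ℝ (L x) y') y v v := by
    intro y hy v hv
    obtain ⟨e₀, he₀⟩ := hinv
    refine hN.hessian_comp_pos e₀.symm (f := L x) ?_ hy hv
    intro y
    rw [hL2.self_of_nhds, ← he₀, ContinuousLinearMap.inverse_equiv]; rfl
  have hdN : ∀ η, η ≠ 0 → HasFDerivAt N (fderiv ℝ N η) η := fun η hη =>
    ((hN.contDiffAt η hη).differentiableAt (by simp)).hasFDerivAt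
  have hde : HasFDerivAt e (fderiv ℝ e x) x := (he.differentiableAt (by simp)).hasFDerivAt
  have hvert : ∀ η, η ≠ 0 → ∀ v, fderiv ℝ (L x) (e x η) v = fderiv ℝ N η (θ v) := by
    intro η hη v
    have h1 : HasFDerivAt (fun y => N (θ y)) ((fderiv ℝ N η).comp θ) (e x η) :=
      HasFDerivAt.comp (e x η) (by rw [hθe]; exact hdN η hη) θ.hasFDerivAt
    have : L x = fun y => N (θ y) := funext hL2.self_of_nhds
    rw [this, h1.fderiv]; rfl
  -- The derivative of the inverse frame comes from differentiating `e x' ((e x').inverse (e x η)) =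
  -- e x η`.
  have hhor : ∀ η, η ≠ 0 → ∀ u, fderiv ℝ (fun x' => L x' (e x η)) x u =
      - fderiv ℝ N η (θ (fderiv ℝ e x u η)) := by
    intro η hη u
    have h1 : HasFDerivAt (fun x' => (e x').inverse (e x η))
        (fderiv ℝ (fun x' => (e x').inverse (e x η)) x) x :=
      ((hθC.clm_apply contDiffAt_const).differentiableAt (by simp)).hasFDerivAt
    have h2 : HasFDerivAt (fun x' => N ((e x').inverse (e x η)))
        ((fderiv ℝ N η).comp (fderiv ℝ (fun x' => (e x').inverse (e x η)) x)) x :=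
      HasFDerivAt.comp (g := N) (f := fun x' => (e x').inverse (e x η)) x
        (by change HasFDerivAt N _ (θ (e x η)); rw [hθe]; exact hdN η hη) h1
    have h3 := hde.clm_apply h1
    have h4 := (hasFDerivAt_const (𝕜 := ℝ) (e x η) x).congr_of_eventuallyEq
      (show (fun x' => e x' ((e x').inverse (e x η))) =ᶠ[𝓝 x] fun _ => e x η from
        hei.mono fun x' (h : (e x').IsInvertible) => h.self_apply_inverse (e x η))
    have h5 := DFunLike.congr_fun (h3.unique h4) u
    simp at h5
    change _ + fderiv ℝ e x u (θ (e x η)) = 0 at h5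
    rw [hθe] at h5
    have h6 := congrArg θ h5
    rw [map_add, hθe, map_zero] at h6
    have h7 : (fun x' => L x' (e x η)) =ᶠ[𝓝 x] fun x' => N ((e x').inverse (e x η)) :=
      hL2.mono fun x' h => h _
    rw [(h2.congr_of_eventuallyEq h7).fderiv, ContinuousLinearMap.comp_apply,
      eq_neg_of_add_eq_zero_left h6, map_neg]
  constructor
  · rintro ⟨Γ₀, hΓ₀⟩
    -- The spray sees only the diagonal of `Γ₀`, so it may be symmetrized.
    set Γ : V →L[ℝ] V →L[ℝ] V := (1 / 2 : ℝ) • (Γ₀ + Γ₀.flip) with hΓ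
    have hs : ∀ u v, Γ u v = Γ v u := by
      intro u v
      change (1 / 2 : ℝ) • (Γ₀ u v + Γ₀ v u) = (1 / 2 : ℝ) • (Γ₀ v u + Γ₀ u v)
      rw [add_comm]
    have hΓ1 : ∀ y, y ≠ 0 → sprayCoefficients L x y = (1 / 2 : ℝ) • Γ y y := by
      intro y hy
      rw [hΓ₀ y hy]
      congr 1
      simp only [hΓ, smul_apply, add_apply,
        ContinuousLinearMap.flip_apply]
      rw [← two_smul ℝ, smul_smul]; norm_num
    have key := (sprayCoefficients_eq_iff hC hh hpos Γ hs).1 hΓ1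
    -- `T w η` is the covariant derivative of the frame field `e η` along `e w`, expressed in the
    -- frame; the symmetry of `Γ` is the torsion identity.
    refine ⟨(ContinuousLinearMap.compL ℝ W V W θ).comp
      ((fderiv ℝ e x).comp (e x) + Γ.bilinearComp (e x) (e x)), ?_, ?_⟩
    · intro w η
      simp only [ContinuousLinearMap.comp_apply, ContinuousLinearMap.compL_apply, map_sub, heθ,
        add_apply, ContinuousLinearMap.bilinearComp_apply]
      rw [hs (e x η)]; abel
    · intro w η hη
      have h0 : e x η ≠ 0 := fun h => hη (by rw [← hθe η, h, map_zero])
      have h1 := key (e x η) h0 (e x w)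
      rw [hhor η hη, hvert η hη] at h1
      simp only [ContinuousLinearMap.comp_apply, ContinuousLinearMap.compL_apply, map_add,
        add_apply, ContinuousLinearMap.bilinearComp_apply]
      linarith
  · rintro ⟨T, hT, hTN⟩
    set Γ : V →L[ℝ] V →L[ℝ] V := (ContinuousLinearMap.compL ℝ V W V (e x)).comp
      (T.bilinearComp θ θ) - ((ContinuousLinearMap.compL ℝ V W V).flip θ).comp (fderiv ℝ e x)
      with hΓ
    have hΓa : ∀ u v, Γ u v = e x (T (θ u) (θ v)) - fderiv ℝ e x u (θ v) := by
      intro u v; simp [hΓ]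
    refine ⟨Γ, (sprayCoefficients_eq_iff hC hh hpos Γ ?_).2 ?_⟩
    · intro u v
      have := hT (θ u) (θ v)
      rw [heθ, heθ, map_sub] at this
      rw [hΓa, hΓa, ← sub_eq_zero]
      rw [← sub_eq_zero] at this
      rw [← this]; abel
    · intro y hy u
      obtain ⟨η, rfl⟩ : ∃ η, y = e x η := ⟨θ y, (heθ y).symm⟩
      have hη : η ≠ 0 := by rintro rfl; simp at hy
      rw [hhor η hη, hvert η hη, hΓa, map_sub, hθe, hθe, map_sub, hTN _ η hη, zero_sub]

end Frames

/-! ### Minkowski norms of `(α, β)` type and their linear symmetries -/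

section AlphaBeta

variable {φ : ℝ → ℝ} {b₀ : ℝ}

theorem two_le_infty : (2 : WithTop ℕ∞) ≤ ∞ := WithTop.coe_le_coe.2 le_top

theorem IsAlphaBetaFunction.contDiffAt (hφ : IsAlphaBetaFunction φ b₀) {s : ℝ} (hs : |s| < b₀) :
    ContDiffAt ℝ ∞ φ s :=
  hφ.contDiffOn.contDiffAt (isOpen_Ioo.mem_nhds (abs_lt.1 hs))

theorem IsAlphaBetaFunction.hasDerivAt (hφ : IsAlphaBetaFunction φ b₀) {s : ℝ} (hs : |s| < b₀) :
    HasDerivAt φ (deriv φ s) s :=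
  ((hφ.contDiffAt hs).differentiableAt (by simp)).hasDerivAt

theorem IsAlphaBetaFunction.hasDerivAt_deriv (hφ : IsAlphaBetaFunction φ b₀) {s : ℝ}
    (hs : |s| < b₀) : HasDerivAt (deriv φ) (deriv (deriv φ) s) s := by
  have h1 := ((hφ.contDiffAt hs).of_le two_le_infty).fderiv_right (m := 1) (by norm_num)
  have h2 : DifferentiableAt ℝ (fun x => fderiv ℝ φ x 1) s :=
    (h1.differentiableAt (by simp)).clm_apply (differentiableAt_const _)
  exact h2.hasDerivAt

/-- The choice `b = |s|` removes the second derivative from the regularity condition. -/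
theorem IsAlphaBetaFunction.sub_mul_deriv_pos (hφ : IsAlphaBetaFunction φ b₀) {s : ℝ}
    (hs : |s| < b₀) : 0 < φ s - s * deriv φ s := by
  simpa using hφ.regular s |s| le_rfl hs

theorem IsAlphaBetaFunction.pos' (hφ : IsAlphaBetaFunction φ b₀) {s : ℝ} (hs : |s| < b₀) :
    0 < φ s := hφ.pos s (abs_lt.1 hs)

/-- The solutions of `φ' = k s (φ - s φ')` are those of Riemannian type. -/
theorem IsAlphaBetaFunction.exists_sq_eq (hφ : IsAlphaBetaFunction φ b₀) {b k : ℝ} (hb : 0 < b)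
    (hb₀ : b < b₀) (h : ∀ s, |s| < b → deriv φ s = k * s * (φ s - s * deriv φ s)) :
    ∃ c₁ c₂ : ℝ, ∀ s, |s| ≤ b → φ s ^ 2 = c₁ + c₂ * s ^ 2 := by
  have hk : ∀ s, |s| < b → 0 < 1 + k * s ^ 2 := by
    intro s hs
    have h1 := hφ.sub_mul_deriv_pos (hs.trans hb₀)
    have h2 := hφ.pos' (hs.trans hb₀)
    -- The equation for `φ'` gives this product formula; both `φ - sφ'` and `φ` being positive, so
    -- is `1 + k s²`.
    have h3 : (φ s - s * deriv φ s) * (1 + k * s ^ 2) = φ s := by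
      linear_combination (-s) * (h s hs)
    exact (mul_pos_iff_of_pos_left h1).1 (by rw [h3]; exact h2)
  have hd : ∀ s ∈ Set.Ioo (-b) b, HasDerivAt (fun s => φ s ^ 2 / (1 + k * s ^ 2)) 0 s := by
    intro s hs
    have hs' := abs_lt.2 hs
    have h1 := ((hφ.hasDerivAt (hs'.trans hb₀)).pow 2).div
      (((hasDerivAt_pow 2 s).const_mul k).const_add 1) (hk s hs').ne'
    refine h1.congr_deriv ?_
    rw [div_eq_zero_iff]; left
    have := h s hs'
    simp
    linear_combination (2 * φ s) * this
  have hconst {x y : ℝ} := isOpen_Ioo.is_const_of_deriv_eq_zero (x := x) (y := y) (s := Set.Ioo (-b) b) isPreconnected_Ioo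
    (fun s hs => (hd s hs).differentiableAt.differentiableWithinAt) (fun s hs => (hd s hs).deriv)
  have h0 : (0 : ℝ) ∈ Set.Ioo (-b) b := ⟨by linarith, hb⟩
  refine ⟨φ 0 ^ 2, φ 0 ^ 2 * k, ?_⟩
  have hE : Set.EqOn (fun s => φ s ^ 2) (fun s => φ 0 ^ 2 + φ 0 ^ 2 * k * s ^ 2)
      (Set.Ioo (-b) b) := by
    intro s hs
    have h1 := hconst hs h0
    have h2 := hk s (abs_lt.2 hs)
    simp at h1
    rw [div_eq_iff h2.ne'] at h1
    simp only [h1]; ring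
  -- The endpoints `±b` are reached by continuity.
  have hE2 : Set.EqOn (fun s => φ s ^ 2) (fun s => φ 0 ^ 2 + φ 0 ^ 2 * k * s ^ 2)
      (Set.Icc (-b) b) := by
    refine hE.of_subset_closure ?_ (by fun_prop) Set.Ioo_subset_Icc_self ?_
    · intro s hs
      exact ((hφ.contDiffAt ((abs_le.2 hs).trans_lt hb₀)).continuousAt.pow 2).continuousWithinAt
    · rw [closure_Ioo (by linarith)]
  exact fun s hs => hE2 (abs_le.1 hs)

variable {W : Type*} [NormedAddCommGroup W] [NormedSpace ℝ W]

/-- The square of the Minkowski norm `α φ(β/α)`, `α(η) = √B(η, η)`, `β(η) = B(X, η)`. -/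
def alphaBetaEnergy (φ : ℝ → ℝ) (B : W →L[ℝ] W →L[ℝ] ℝ) (X η : W) : ℝ :=
  (√(B η η) * φ (B X η / √(B η η))) ^ 2

variable {B : W →L[ℝ] W →L[ℝ] ℝ} {X : W}

theorem inner_sq_le (hs : ∀ v w, B v w = B w v) (hp : ∀ v, v ≠ 0 → 0 < B v v) (v w : W) :
    B v w ^ 2 ≤ B v v * B w w := by
  by_cases hv : v = 0
  · simp [hv]
  have h1 := hp v hv
  have h2 : 0 ≤ B (B v v • w - B v w • v) (B v v • w - B v w • v) := by
    by_cases h : B v v • w - B v w • v = 0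
    · simp [h]
    · exact (hp _ h).le
  simp only [map_sub, map_smul, sub_apply, smul_apply, smul_eq_mul] at h2
  rw [hs w v] at h2
  have h3 : 0 ≤ B v v * (B v v * B w w - B v w ^ 2) := by linarith
  linarith [nonneg_of_mul_nonneg_right h3 h1]

theorem abs_div_sqrt_le (hs : ∀ v w, B v w = B w v) (hp : ∀ v, v ≠ 0 → 0 < B v v) {η : W}
    (hη : η ≠ 0) : |B X η / √(B η η)| ≤ √(B X X) := by
  have h1 := hp η hη
  have h2 := inner_sq_le hs hp X η
  rw [abs_div, abs_of_pos (Real.sqrt_pos.2 h1), div_le_iff₀ (Real.sqrt_pos.2 h1),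
    ← Real.sqrt_mul' _ h1.le]
  exact Real.abs_le_sqrt h2

variable (hs : ∀ v w, B v w = B w v) (hp : ∀ v, v ≠ 0 → 0 < B v v)
  (hφ : IsAlphaBetaFunction φ b₀) (hX : √(B X X) < b₀)

include hs hp hφ hX

theorem contDiffAt_alphaBetaEnergy {η : W} (hη : η ≠ 0) :
    ContDiffAt ℝ ∞ (alphaBetaEnergy φ B X) η := by
  have h1 : ContDiffAt ℝ ∞ (fun η => √(B η η)) η := by
    refine ContDiffAt.sqrt ?_ (hp η hη).ne'
    exact (B.contDiff.contDiffAt).clm_apply contDiffAt_id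
  have h2 : ContDiffAt ℝ ∞ (fun η => B X η / √(B η η)) η :=
    (B X).contDiff.contDiffAt.div h1 (Real.sqrt_pos.2 (hp η hη)).ne'
  have h3 : ContDiffAt ℝ ∞ φ (B X η / √(B η η)) :=
    hφ.contDiffAt ((abs_div_sqrt_le hs hp hη).trans_lt hX)
  exact (h1.mul (h3.comp η h2)).pow 2

omit hφ hX hs in
theorem hasDerivAt_sqrt_line {η : W} (hη : η ≠ 0) (v : W) (hs : ∀ v w, B v w = B w v) :
    HasDerivAt (fun t : ℝ => √(B (η + t • v) (η + t • v))) (B η v / √(B η η)) 0 := by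
  have h1 : HasDerivAt (fun t : ℝ => η + t • v) v 0 := by
    simpa using ((hasDerivAt_id (0 : ℝ)).smul_const v).const_add η
  have h2 : HasDerivAt (fun t : ℝ => B (η + t • v) (η + t • v)) (2 * B η v) 0 := by
    have := (B.hasFDerivAt.comp_hasDerivAt (0 : ℝ) h1).clm_apply h1
    refine this.congr_deriv ?_
    simp [hs v η]; ring
  have h3 := h2.sqrt (by simpa using (hp η hη).ne')
  refine h3.congr_deriv ?_
  simp
  rw [mul_div_mul_left _ _ two_ne_zero]

omit hφ hX in
theorem hasDerivAt_ratio_line {η : W} (hη : η ≠ 0) (v : W) :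
    HasDerivAt (fun t : ℝ => B X (η + t • v) / √(B (η + t • v) (η + t • v)))
      ((B X v - B X η / √(B η η) * (B η v / √(B η η))) / √(B η η)) 0 := by
  have h1 : HasDerivAt (fun t : ℝ => B X (η + t • v)) (B X v) 0 := by
    have h1 : HasDerivAt (fun t : ℝ => η + t • v) v 0 := by
      simpa using ((hasDerivAt_id (0 : ℝ)).smul_const v).const_add η
    exact (B X).hasFDerivAt.comp_hasDerivAt (0 : ℝ) h1
  have h0 := Real.sqrt_pos.2 (hp η hη)
  have h2 := h1.div (hasDerivAt_sqrt_line hp hη v hs) (by simpa using h0.ne')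
  refine h2.congr_deriv ?_
  simp
  field_simp

theorem fderiv_alphaBetaEnergy {η : W} (hη : η ≠ 0) (v : W) :
    fderiv ℝ (alphaBetaEnergy φ B X) η v =
      2 * (√(B η η) * φ (B X η / √(B η η))) * (φ (B X η / √(B η η)) * (B η v / √(B η η)) +
        deriv φ (B X η / √(B η η)) *
          (B X v - B X η / √(B η η) * (B η v / √(B η η)))) := by
  have h1 : HasDerivAt (fun t : ℝ => η + t • v) v 0 := by
    simpa using ((hasDerivAt_id (0 : ℝ)).smul_const v).const_add η
  have h2 : HasDerivAt (fun t : ℝ => alphaBetaEnergy φ B X (η + t • v))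
      (fderiv ℝ (alphaBetaEnergy φ B X) η v) 0 := by
    refine HasFDerivAt.comp_hasDerivAt (l := alphaBetaEnergy φ B X) (0 : ℝ) ?_ h1
    simpa using ((contDiffAt_alphaBetaEnergy hs hp hφ hX hη).differentiableAt (by simp)).hasFDerivAt
  have h0 := Real.sqrt_pos.2 (hp η hη)
  have h3 := hasDerivAt_ratio_line hs hp (X := X) hη v
  have h4 := hφ.hasDerivAt ((abs_div_sqrt_le hs hp hη).trans_lt hX)
  have h5 : HasDerivAt (fun t : ℝ => φ (B X (η + t • v) / √(B (η + t • v) (η + t • v)))) _ 0 :=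
    HasDerivAt.comp (h₂ := φ) (h₂' := deriv φ (B X η / √(B η η))) (0 : ℝ)
      (by simp only [zero_smul, add_zero]; exact h4) h3
  have h6 := ((hasDerivAt_sqrt_line hp hη v hs).mul h5).pow 2
  refine h2.unique (h6.congr_deriv ?_)
  simp only [zero_smul, add_zero, Pi.mul_apply]
  field_simp
  ring

/-- With `m = β/α`, `ρ = B(η, v)/α` and `q = B(X, v) - mρ`, half the Hessian is `(φρ + φ'q)² + φ((φ
- mφ')(B(v, v) - ρ²) + φ''q²)`. Cauchy–Schwarz gives `q² ≤ (b² - m²)(B(v, v) - ρ²)`. For `φ'' < 0`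
this bound and the regularity condition at `b = √B(X, X)` make the bracket positive; for `φ'' ≥ 0`
the inequality `φ - mφ' > 0` suffices. If `B(v, v) = ρ²`, then `q = 0` and `φ²ρ²` remains. -/
theorem hessian_alphaBetaEnergy_pos {η : W} (hη : η ≠ 0) {v : W} (hv : v ≠ 0) :
    0 < fderiv ℝ (fderiv ℝ (alphaBetaEnergy φ B X)) η v v := by
  have h1 : HasDerivAt (fun t : ℝ => η + t • v) v 0 := by
    simpa using ((hasDerivAt_id (0 : ℝ)).smul_const v).const_add η
  have h2 : HasDerivAt (fun t : ℝ => fderiv ℝ (alphaBetaEnergy φ B X) (η + t • v) v)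
      (fderiv ℝ (fderiv ℝ (alphaBetaEnergy φ B X)) η v v) 0 := by
    have h : HasFDerivAt (fderiv ℝ (alphaBetaEnergy φ B X))
        (fderiv ℝ (fderiv ℝ (alphaBetaEnergy φ B X)) η) (η + (0 : ℝ) • v) := by
      simpa using ((((contDiffAt_alphaBetaEnergy hs hp hφ hX hη).of_le two_le_infty).fderiv_right
        (m := 1) (by norm_num)).differentiableAt (by simp)).hasFDerivAt
    have h' : HasDerivAt (fun t : ℝ => fderiv ℝ (alphaBetaEnergy φ B X) (η + t • v))
        (fderiv ℝ (fderiv ℝ (alphaBetaEnergy φ B X)) η v) 0 :=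
      HasFDerivAt.comp_hasDerivAt (l := fderiv ℝ (alphaBetaEnergy φ B X)) (0 : ℝ) h h1
    refine (h'.clm_apply (hasDerivAt_const (0 : ℝ) v)).congr_deriv ?_
    rw [map_zero, add_zero]
  have hr := Real.sqrt_pos.2 (hp η hη)
  have hr2 := Real.sq_sqrt (hp η hη).le
  have hsq := (hp η hη).ne'
  have hsb := abs_div_sqrt_le (X := X) hs hp hη
  have hsb₀ := hsb.trans_lt hX
  have h3 := hasDerivAt_ratio_line hs hp (X := X) hη v
  have h4 : HasDerivAt (fun t : ℝ => φ (B X (η + t • v) / √(B (η + t • v) (η + t • v)))) _ 0 :=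
    HasDerivAt.comp (h₂ := φ) (h₂' := deriv φ (B X η / √(B η η))) (0 : ℝ)
      (by simp only [zero_smul, add_zero]; exact hφ.hasDerivAt hsb₀) h3
  have h5 : HasDerivAt (fun t : ℝ => deriv φ (B X (η + t • v) / √(B (η + t • v) (η + t • v)))) _ 0 :=
    HasDerivAt.comp (h₂ := deriv φ) (h₂' := deriv (deriv φ) (B X η / √(B η η))) (0 : ℝ)
      (by simp only [zero_smul, add_zero]; exact hφ.hasDerivAt_deriv hsb₀) h3
  have h6 : HasDerivAt (fun t : ℝ => B (η + t • v) v) (B v v) 0 := by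
    simpa using (B.hasFDerivAt.comp_hasDerivAt (0 : ℝ) h1).clm_apply (hasDerivAt_const (0 : ℝ) v)
  have h7 := h6.div (hasDerivAt_sqrt_line hp hη v hs) (by simpa using hr.ne')
  have h8 := (((hasDerivAt_sqrt_line hp hη v hs).mul h4).const_mul 2).mul
    ((h4.mul h7).add (h5.mul ((h3.mul h7).const_sub (B X v))))
  have hne : ∀ᶠ t : ℝ in 𝓝 0, η + t • v ≠ 0 := by
    have : Filter.Tendsto (fun t : ℝ => η + t • v) (𝓝 0) (𝓝 η) := by
      simpa using h1.continuousAt.tendsto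
    exact this.eventually (isOpen_ne.mem_nhds hη)
  have h9 := h8.congr_of_eventuallyEq
    (show (fun t : ℝ => fderiv ℝ (alphaBetaEnergy φ B X) (η + t • v) v) =ᶠ[𝓝 0] _ from
      hne.mono fun t ht => fderiv_alphaBetaEnergy hs hp hφ hX ht v)
  rw [h2.unique h9]
  simp only [zero_smul, add_zero, Pi.add_apply, Pi.mul_apply, Pi.div_apply]
  -- the quantities of the classical formula
  have hCS := inner_sq_le hs hp (X - (B X η / √(B η η) / √(B η η)) • η)
    (v - (B η v / √(B η η) / √(B η η)) • η)
  simp only [map_sub, map_smul, sub_apply, smul_apply, smul_eq_mul] at hCS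
  rw [hs η X, hs v η] at hCS
  have hA : 0 ≤ B v v - (B η v / √(B η η)) ^ 2 := by
    have := inner_sq_le hs hp η v
    rw [div_pow, hr2, sub_nonneg, div_le_iff₀ (hp η hη)]
    linarith
  have hBη : B η η = √(B η η) ^ 2 := hr2.symm
  have hbX : √(B X X) ^ 2 = B X X := by
    refine Real.sq_sqrt ?_
    by_cases h : X = 0
    · simp [h]
    · exact (hp X h).le
  have hreg := hφ.regular _ _ hsb hX
  have hreg0 := hφ.sub_mul_deriv_pos hsb₀
  have hφp := hφ.pos' hsb₀
  have hvp := hp v hv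
  rw [hbX] at hreg
  generalize hrr : √(B η η) = r at *
  rw [hBη] at hCS
  obtain ⟨m, hm⟩ : ∃ m, B X η = m * r := ⟨B X η / r, by field_simp⟩
  obtain ⟨ρ, hρ⟩ : ∃ ρ, B η v = ρ * r := ⟨B η v / r, by field_simp⟩
  have e1 : B X η / r = m := by rw [hm]; field_simp
  have e2 : B η v / r = ρ := by rw [hρ]; field_simp
  simp only [e1, e2] at *
  rw [hm, hρ] at hCS
  have hC : (B X v - m * ρ) ^ 2 ≤ (B X X - m ^ 2) * (B v v - ρ ^ 2) := by
    have l : B X v - m / r * (ρ * r) - ρ / r * (m * r - m / r * r ^ 2) = B X v - m * ρ := by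
      field_simp; ring
    have r1 : B X X - m / r * (m * r) - m / r * (m * r - m / r * r ^ 2) = B X X - m ^ 2 := by
      field_simp; ring
    have r2 : B v v - ρ / r * (ρ * r) - ρ / r * (ρ * r - ρ / r * r ^ 2) = B v v - ρ ^ 2 := by
      field_simp; ring
    rw [← l, ← r1, ← r2]
    exact hCS
  have hr0 : r ≠ 0 := hr.ne'
  have key : 0 < (φ m * ρ + deriv φ m * (B X v - m * ρ)) ^ 2 + φ m *
      ((φ m - m * deriv φ m) * (B v v - ρ ^ 2) + deriv (deriv φ) m * (B X v - m * ρ) ^ 2) := by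
    rcases hA.eq_or_lt with h | h
    · have hC0 : B X v - m * ρ = 0 := by
        rw [← h, mul_zero] at hC
        exact pow_eq_zero_iff two_ne_zero |>.1 (le_antisymm hC (sq_nonneg _))
      rw [← h, hC0]
      have hρ0 : 0 < ρ ^ 2 := by linarith
      have : 0 < φ m ^ 2 * ρ ^ 2 := by positivity
      nlinarith
    · have : 0 < (φ m - m * deriv φ m) * (B v v - ρ ^ 2) +
          deriv (deriv φ) m * (B X v - m * ρ) ^ 2 := by
        rcases le_or_gt 0 (deriv (deriv φ) m) with h' | h'
        · have := mul_pos hreg0 h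
          have := mul_nonneg h' (sq_nonneg (B X v - m * ρ))
          linarith
        · have h3 := mul_le_mul_of_nonpos_left hC h'.le
          have h4 := mul_pos hreg h
          linarith
      have := mul_pos hφp this
      positivity
  refine lt_of_lt_of_eq (mul_pos two_pos key) ?_
  rw [hρ]
  field_simp
  ring

theorem isMinkowskiEnergy_alphaBetaEnergy : IsMinkowskiEnergy (alphaBetaEnergy φ B X) where
  contDiffAt η hη := (contDiffAt_alphaBetaEnergy hs hp hφ hX hη).of_le two_le_infty
  homogeneous t ht η := by
    have h1 : √(B (t • η) (t • η)) = t * √(B η η) := by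
      simp only [map_smul, smul_apply, smul_eq_mul]
      rw [← mul_assoc, Real.sqrt_mul (by positivity), Real.sqrt_mul_self ht.le]
    unfold alphaBetaEnergy
    rw [h1, map_smul, smul_eq_mul, mul_div_mul_left _ _ ht.ne']
    ring
  hessian_pos η hη v hv := hessian_alphaBetaEnergy_pos hs hp hφ hX hη hv

theorem fderiv_alphaBetaEnergy_eq_zero {η v : W} (hη : η ≠ 0) (h1 : B η v = 0) (h2 : B X v = 0) :
    fderiv ℝ (alphaBetaEnergy φ B X) η v = 0 := by
  rw [fderiv_alphaBetaEnergy hs hp hφ hX hη, h1, h2]; simp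

/-- The linear vector fields that preserve a non-Riemannian `(α, β)`-norm preserve `α` and `β`. -/
theorem isotropy_alphaBetaEnergy (hX0 : X ≠ 0) {f : W} (hf : f ≠ 0) (hXf : B X f = 0)
    (hRiem : ¬ ∃ c₁ c₂ : ℝ, ∀ s : ℝ, |s| ≤ √(B X X) → φ s ^ 2 = c₁ + c₂ * s ^ 2)
    (T : W →L[ℝ] W) (hT : ∀ η, η ≠ 0 → fderiv ℝ (alphaBetaEnergy φ B X) η (T η) = 0) (η : W) :
    B η (T η) = 0 ∧ B X (T η) = 0 := by
  set b := √(B X X) with hb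
  have hb0 : 0 < b := Real.sqrt_pos.2 (hp X hX0)
  have hb2 : b ^ 2 = B X X := Real.sq_sqrt (hp X hX0).le
  have hmain : ∀ η, η ≠ 0 → (φ (B X η / √(B η η)) -
      B X η / √(B η η) * deriv φ (B X η / √(B η η))) * B η (T η) +
      deriv φ (B X η / √(B η η)) * √(B η η) * B X (T η) = 0 := by
    intro η hη
    have h1 := hT η hη
    have hr := Real.sqrt_pos.2 (hp η hη)
    have hφp := hφ.pos' ((abs_div_sqrt_le (X := X) hs hp hη).trans_lt hX)
    rw [fderiv_alphaBetaEnergy hs hp hφ hX hη, mul_eq_zero] at h1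
    have h2 := h1.resolve_left (by positivity)
    have h3 := congrArg (fun z => √(B η η) * z) h2
    simp only [mul_zero] at h3
    rw [← h3]
    field_simp
    ring
  -- On the circle `σX + cf` of radius `b`, `β/α` equals `σb`. The sign of `c` does not affect it,
  -- so the parts odd and even in `c` vanish separately.
  have hline : ∀ f : W, B f f = b ^ 2 → B X f = 0 → ∀ σ c : ℝ, σ ^ 2 + c ^ 2 = 1 →
      (φ (σ * b) - σ * b * deriv φ (σ * b)) * (σ ^ 2 * B X (T X) +
        σ * c * (B X (T f) + B f (T X)) + c ^ 2 * B f (T f)) +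
      deriv φ (σ * b) * b * (σ * B X (T X) + c * B X (T f)) = 0 := by
    intro f hff hXf σ c hσ
    have h1 : B (σ • X + c • f) (σ • X + c • f) = b ^ 2 := by
      simp only [map_add, map_smul, add_apply, smul_apply, smul_eq_mul]
      rw [hs f X, hXf, hff, ← hb2]
      linear_combination b ^ 2 * hσ
    have h0 : σ • X + c • f ≠ 0 := by
      intro h; rw [h] at h1; simp at h1; exact hb0.ne' (by simpa using h1.symm)
    have h2 : B X (σ • X + c • f) / b = σ * b := by
      simp only [map_add, map_smul, smul_eq_mul]
      rw [hXf, ← hb2]; field_simp; ring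
    have h3 := hmain _ h0
    rw [h1, Real.sqrt_sq hb0.le, h2] at h3
    simp only [map_add, map_smul, add_apply, smul_apply, smul_eq_mul] at h3
    rw [← h3]
    ring
  have habs : ∀ s, |s| < b → ∃ σ c : ℝ, σ * b = s ∧ σ ^ 2 + c ^ 2 = 1 ∧ c ≠ 0 := by
    intro s hs'
    have h1 : (s / b) ^ 2 < 1 := by
      rw [div_pow, div_lt_one (by positivity)]
      exact sq_lt_sq' (abs_lt.1 hs').1 (abs_lt.1 hs').2
    refine ⟨s / b, √(1 - (s / b) ^ 2), by field_simp, ?_, ?_⟩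
    · rw [Real.sq_sqrt (by linarith)]; ring
    · exact (Real.sqrt_pos.2 (by linarith)).ne'
  have hlf : ∀ f : W, B f f = b ^ 2 → B X f = 0 → B X (T f) = 0 := by
    intro f hff hXf
    by_contra hne
    apply hRiem
    -- If `B X (T f) ≠ 0`, the odd part solves for `φ'` and gives the Riemannian equation with this
    -- `k`.
    refine hφ.exists_sq_eq (k := - (B X (T f) + B f (T X)) / (b ^ 2 * B X (T f))) hb0 hX ?_
    intro s hs'
    obtain ⟨σ, c, rfl, hσ, hc⟩ := habs s hs'
    have h1 := hline f hff hXf σ c hσ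
    have h2 := hline f hff hXf σ (-c) (by linarith)
    have h3 : c * ((φ (σ * b) - σ * b * deriv φ (σ * b)) * (σ * (B X (T f) + B f (T X))) +
      deriv φ (σ * b) * b * B X (T f)) = 0 := by linear_combination (h1 - h2) / 2
    have h4 := (mul_eq_zero.1 h3).resolve_left hc
    have hbb := hb0.ne'
    field_simp
    linear_combination h4
  have hlX : B X (T X) = 0 := by
    obtain ⟨f', hff', hXf'⟩ : ∃ f', B f' f' = b ^ 2 ∧ B X f' = 0 := by
      refine ⟨(b / √(B f f)) • f, ?_, ?_⟩
      · simp only [map_smul, smul_apply, smul_eq_mul]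
        have h1 := Real.sqrt_pos.2 (hp f hf)
        have h2 := Real.sq_sqrt (hp f hf).le
        rw [← mul_assoc, ← sq, div_pow, h2]
        field_simp [(hp f hf).ne']
      · simp [hXf]
    by_contra hne
    apply hRiem
    -- This is the even part. At `s = 0` it kills `B f' (T f')`; then `B X (T X) ≠ 0` would force
    -- the Riemannian equation with `k = -1/b²`, first for `s ≠ 0` and by continuity at `0`.
    have heq : ∀ s, |s| < b → s * ((φ s - s * deriv φ s) * (s / b ^ 2) + deriv φ s) * B X (T X) +
        (φ s - s * deriv φ s) * ((1 - (s / b) ^ 2) * B f' (T f')) = 0 := by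
      intro s hs'
      obtain ⟨σ, c, rfl, hσ, hc⟩ := habs s hs'
      have h1 := hline f' hff' hXf' σ c hσ
      have h2 := hline f' hff' hXf' σ (-c) (by linarith)
      have h3 : c ^ 2 = 1 - σ ^ 2 := by linarith
      rw [mul_div_cancel_right₀ _ hb0.ne']
      have : σ * b / b ^ 2 = σ / b := by field_simp
      rw [this]
      have : σ * b * ((φ (σ * b) - σ * b * deriv φ (σ * b)) * (σ / b) + deriv φ (σ * b)) =
        (φ (σ * b) - σ * b * deriv φ (σ * b)) * σ ^ 2 + deriv φ (σ * b) * b * σ := by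
        field_simp
      rw [this, ← h3]
      linear_combination (h1 + h2) / 2
    have hQ : B f' (T f') = 0 := by
      have h1 := heq 0 (by simpa using hb0)
      simp at h1
      exact h1.resolve_left (hφ.pos' (by simpa using hb0.trans hX)).ne'
    have hcont : ContinuousAt (fun s => (φ s - s * deriv φ s) * (s / b ^ 2) + deriv φ s) 0 := by
      have h0 : |(0 : ℝ)| < b₀ := by simpa using hb0.trans hX
      have h1 := (hφ.contDiffAt h0).continuousAt
      have h2 := (hφ.hasDerivAt_deriv h0).continuousAt
      fun_prop
    have hne0 : ∀ s, |s| < b → s ≠ 0 →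
        (φ s - s * deriv φ s) * (s / b ^ 2) + deriv φ s = 0 := by
      intro s hs' hs0
      have h1 := heq s hs'
      rw [hQ] at h1
      simpa [hne, hs0] using h1
    have hall : ∀ s, |s| < b → (φ s - s * deriv φ s) * (s / b ^ 2) + deriv φ s = 0 := by
      intro s hs'
      by_cases hs0 : s = 0
      · subst hs0
        have h1 : Filter.Tendsto (fun s => (φ s - s * deriv φ s) * (s / b ^ 2) + deriv φ s)
          (𝓝[≠] 0) (𝓝 _) := hcont.tendsto.mono_left nhdsWithin_le_nhds
        have h2 : Filter.Tendsto (fun s => (φ s - s * deriv φ s) * (s / b ^ 2) + deriv φ s)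
            (𝓝[≠] 0) (𝓝 0) := by
          refine tendsto_const_nhds.congr' ?_
          have : ∀ᶠ s : ℝ in 𝓝[≠] 0, |s| < b := by
            refine nhdsWithin_le_nhds ?_
            exact (continuous_abs.tendsto (0 : ℝ)).eventually (gt_mem_nhds (by simpa using hb0))
          filter_upwards [this, self_mem_nhdsWithin] with s h h'
          exact (hne0 s h h').symm
        exact tendsto_nhds_unique h1 h2
      · exact hne0 s hs' hs0
    refine hφ.exists_sq_eq (k := - 1 / b ^ 2) hb0 hX ?_
    intro s hs'
    linear_combination hall s hs'
  have hl : ∀ η, B X (T η) = 0 := by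
    intro η
    -- Split `η` into its component along `X` and an orthogonal one, which is rescaled to length
    -- `b`.
    set c := B X η / B X X with hc
    have hXX := (hp X hX0).ne'
    have h1 : B X (η - c • X) = 0 := by
      simp [hc, hXX]
    have h2 : B X (T (η - c • X)) = 0 := by
      by_cases h0 : η - c • X = 0
      · simp [h0]
      set f' := η - c • X
      have h3 := hp f' h0
      have h4 := Real.sqrt_pos.2 h3
      have h5 := hlf ((b / √(B f' f')) • f') (by
        simp only [map_smul, smul_apply, smul_eq_mul]
        have h2 := Real.sq_sqrt h3.le
        rw [← mul_assoc, ← sq, div_pow, h2]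
        field_simp [h3.ne']) (by simp [h1])
      simp only [map_smul, smul_eq_mul, mul_eq_zero] at h5
      exact h5.resolve_left (by positivity)
    simpa [hlX] using h2
  refine ⟨?_, hl η⟩
  by_cases hη : η = 0
  · simp [hη]
  have h1 := hmain η hη
  rw [hl, mul_zero, add_zero, mul_eq_zero] at h1
  exact h1.resolve_left
    (hφ.sub_mul_deriv_pos ((abs_div_sqrt_le (X := X) hs hp hη).trans_lt hX)).ne'

end AlphaBeta

/-! ### Berwald type as parallelism of `X` -/

section Connections

variable {W : Type*} [NormedAddCommGroup W] [NormedSpace ℝ W]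
  {B : W →L[ℝ] W →L[ℝ] ℝ}

theorem eq_of_forall_inner_eq (hp : ∀ v, v ≠ 0 → 0 < B v v) {v w : W}
    (h : ∀ ζ, B v ζ = B w ζ) : v = w := by
  by_contra hne
  have h1 := hp (v - w) (sub_ne_zero.2 hne)
  have h2 := h (v - w)
  rw [map_sub B v w, sub_apply] at h1
  linarith

theorem exists_forall_inner_eq [FiniteDimensional ℝ W] (hp : ∀ v, v ≠ 0 → 0 < B v v)
    (l : W →L[ℝ] ℝ) : ∃ v, ∀ ζ, B v ζ = l ζ := by
  have hinj : Function.Injective B.toLinearMap := fun v w h =>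
    eq_of_forall_inner_eq hp fun ζ => DFunLike.congr_fun h ζ
  have hfr : Module.finrank ℝ W = Module.finrank ℝ (W →L[ℝ] ℝ) := by
    rw [(LinearMap.toContinuousLinearMap (𝕜 := ℝ) (E := W) (F' := ℝ)).symm.finrank_eq]
    exact Subspace.dual_finrank_eq.symm
  obtain ⟨v, hv⟩ := (LinearMap.injective_iff_surjective_of_finrank_eq_finrank hfr).1 hinj l
  exact ⟨v, fun ζ => DFunLike.congr_fun hv ζ⟩

/-- A skew-symmetric bilinear map is the torsion of a unique metric connection, given by Koszul's
formula. -/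
theorem exists_koszul_connection [FiniteDimensional ℝ W] (hp : ∀ v, v ≠ 0 → 0 < B v v)
    (C : W →L[ℝ] W →L[ℝ] W) :
    ∃ T : W →L[ℝ] W →L[ℝ] W, ∀ w η ζ,
      B (T w η) ζ = (1 / 2 : ℝ) * (B (C w η) ζ - B (C η ζ) w + B (C ζ w) η) := by
  have hl : ∀ w η : W, ∃ v, ∀ ζ,
      B v ζ = (1 / 2 : ℝ) * (B (C w η) ζ - B (C η ζ) w + B (C ζ w) η) := by
    intro w η
    obtain ⟨v, hv⟩ := exists_forall_inner_eq hp
      ((1 / 2 : ℝ) • (B (C w η) - (B.flip w).comp (C η) + (B.flip η).comp (C.flip w)))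
    exact ⟨v, fun ζ => by rw [hv]; simp; ring⟩
  choose D hD using hl
  let T₀ : W →ₗ[ℝ] W →ₗ[ℝ] W := LinearMap.mk₂ ℝ D
    (fun w w' η => eq_of_forall_inner_eq hp fun ζ => by simp [hD]; ring)
    (fun a w η => eq_of_forall_inner_eq hp fun ζ => by simp [hD]; ring)
    (fun w η η' => eq_of_forall_inner_eq hp fun ζ => by simp [hD]; ring)
    (fun a w η => eq_of_forall_inner_eq hp fun ζ => by simp [hD]; ring)
  exact ⟨LinearMap.toContinuousLinearMap
    ((LinearMap.toContinuousLinearMap (𝕜 := ℝ) (E := W) (F' := W)).toLinearMap ∘ₗ T₀), hD⟩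

variable {V : Type*} [NormedAddCommGroup V] [NormedSpace ℝ V] [FiniteDimensional ℝ V]
  [FiniteDimensional ℝ W] {φ : ℝ → ℝ} {b₀ : ℝ} {X : W} {L : V → V → ℝ} {e : V → W →L[ℝ] V} {x : V}
  {c : W → W → W}

/-- An `(α, β)`-metric with constant coefficients in a frame has quadratic spray coefficients if
the dual of `β` is a Killing field and `β` is closed. -/
theorem exists_sprayCoefficients_eq_of_parallel (hs : ∀ v w, B v w = B w v)
    (hp : ∀ v, v ≠ 0 → 0 < B v v) (hφ : IsAlphaBetaFunction φ b₀) (hX : √(B X X) < b₀)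
    (he : ContDiffAt ℝ 2 e x) (hinv : (e x).IsInvertible)
    (hL : ∀ᶠ x' in 𝓝 x, ∀ η, L x' (e x' η) = alphaBetaEnergy φ B X η)
    (hc : ∀ w η, e x (c w η) = fderiv ℝ e x (e x w) η - fderiv ℝ e x (e x η) w)
    (h1 : ∀ w η, B X (c w η) = 0) (h2 : ∀ w η, B (c X w) η + B (c X η) w = 0) :
    ∃ Γ : V →L[ℝ] V →L[ℝ] V, ∀ y, y ≠ 0 →
      sprayCoefficients L x y = (1 / 2 : ℝ) • Γ y y := by
  have : CompleteSpace W := FiniteDimensional.complete ℝ W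
  rw [exists_sprayCoefficients_eq_iff (isMinkowskiEnergy_alphaBetaEnergy hs hp hφ hX) he hinv hL]
  -- The bracket `c` is only a function; writing it as `A - A.flip` supplies the bilinearity and
  -- antisymmetry that Koszul's formula needs.
  let A : W →L[ℝ] W →L[ℝ] W := (ContinuousLinearMap.compL ℝ W V W (e x).inverse).comp
    ((fderiv ℝ e x).comp (e x))
  have hC : ∀ w η, (A - A.flip) w η = c w η := by
    intro w η
    rw [← hinv.inverse_apply_self (c w η), hc, map_sub]; rfl
  have hanti : ∀ w η, c w η = - c η w := by
    intro w η; rw [← hC, ← hC]; simp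
  obtain ⟨T, hT⟩ := exists_koszul_connection hp (A - A.flip)
  simp only [hC] at hT
  refine ⟨T, ?_, ?_⟩
  · intro w η
    rw [← hc]
    congr 1
    refine eq_of_forall_inner_eq hp fun ζ => ?_
    rw [map_sub, sub_apply, hT, hT, hanti η w, hanti η ζ, hanti ζ w]
    simp; ring
  · intro w η hη
    -- `T w` preserves `α` because it is metric, and `β` because closedness and the Killing equation
    -- cancel the Koszul terms of `B (T w η) X`.
    refine fderiv_alphaBetaEnergy_eq_zero hs hp hφ hX hη ?_ ?_
    · rw [hs, hT, hanti η w]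
      have : c η η = 0 := by
        have := hanti η η
        rwa [eq_neg_iff_add_eq_zero, ← two_smul ℝ, smul_eq_zero_iff_right two_ne_zero] at this
      rw [this]; simp
    · rw [hs, hT, hs (c w η), h1, hanti η X]
      have := h2 w η
      simp; linarith

/-- By the isotropy lemma each `T w` is skew and has image orthogonal to `X`, hence `T w X = 0`.
With `c w η = T w η - T η w` the first claim follows, and `c X w = T X w` is skew in `w`. -/
theorem parallel_of_exists_sprayCoefficients_eq (hs : ∀ v w, B v w = B w v)
    (hp : ∀ v, v ≠ 0 → 0 < B v v) (hφ : IsAlphaBetaFunction φ b₀) (hX : √(B X X) < b₀)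
    (hX0 : X ≠ 0) {f : W} (hf : f ≠ 0) (hXf : B X f = 0)
    (hRiem : ¬ ∃ c₁ c₂ : ℝ, ∀ s : ℝ, |s| ≤ √(B X X) → φ s ^ 2 = c₁ + c₂ * s ^ 2)
    (he : ContDiffAt ℝ 2 e x) (hinv : (e x).IsInvertible)
    (hL : ∀ᶠ x' in 𝓝 x, ∀ η, L x' (e x' η) = alphaBetaEnergy φ B X η)
    (hc : ∀ w η, e x (c w η) = fderiv ℝ e x (e x w) η - fderiv ℝ e x (e x η) w)
    (hB : ∃ Γ : V →L[ℝ] V →L[ℝ] V, ∀ y, y ≠ 0 →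
      sprayCoefficients L x y = (1 / 2 : ℝ) • Γ y y) :
    (∀ w η, B X (c w η) = 0) ∧ ∀ w η, B (c X w) η + B (c X η) w = 0 := by
  have : CompleteSpace W := FiniteDimensional.complete ℝ W
  obtain ⟨T, hT, hTN⟩ := (exists_sprayCoefficients_eq_iff
    (isMinkowskiEnergy_alphaBetaEnergy hs hp hφ hX) he hinv hL).1 hB
  have hcT : ∀ w η, c w η = T w η - T η w := by
    intro w η
    rw [← hinv.inverse_apply_self (c w η), hc, ← hT, hinv.inverse_apply_self]
  have hiso := fun w => isotropy_alphaBetaEnergy hs hp hφ hX hX0 hf hXf hRiem (T w) (hTN w)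
  have hskew : ∀ w η ζ, B (T w η) ζ + B (T w ζ) η = 0 := by
    intro w η ζ
    have h1 := (hiso w (η + ζ)).1
    have h2 := (hiso w η).1
    have h3 := (hiso w ζ).1
    simp only [map_add, add_apply] at h1
    rw [hs (T w η) ζ, hs (T w ζ) η]
    linarith
  have hTX : ∀ w, T w X = 0 := by
    intro w
    refine eq_of_forall_inner_eq hp fun ζ => ?_
    have h1 := hskew w X ζ
    rw [hs (T w ζ) X, (hiso w ζ).2] at h1
    simpa using h1
  refine ⟨fun w η => ?_, fun w η => ?_⟩
  · rw [hcT, map_sub, (hiso w η).2, (hiso η w).2, sub_zero]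
  · rw [hcT, hcT, hTX, hTX, sub_zero, sub_zero]
    exact hskew X w η

end Connections

/-! ### Vector fields in charts -/

section Charts

variable {E : Type*} [NormedAddCommGroup E] [NormedSpace ℝ E]
  {M : Type*} [TopologicalSpace M] [ChartedSpace E M] [IsManifold 𝓘(ℝ, E) ∞ M]

omit [IsManifold 𝓘(ℝ, E) ∞ M] in
theorem coordField_eq_mpullback (V : ∀ x : M, TangentSpace 𝓘(ℝ, E) x) (x₀ : M) :
    coordField 𝓘(ℝ, E) V x₀ = mpullback 𝓘(ℝ, E) 𝓘(ℝ, E) (extChartAt 𝓘(ℝ, E) x₀).symm V := by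
  ext u
  simp only [coordField, mpullback, modelWithCornersSelf_coe, Set.range_id, mfderivWithin_univ]
  rfl

theorem isInvertible_mfderiv_extChartAt_symm {x₀ : M} {x : E}
    (hx : x ∈ (extChartAt 𝓘(ℝ, E) x₀).target) :
    (mfderiv 𝓘(ℝ, E) 𝓘(ℝ, E) (extChartAt 𝓘(ℝ, E) x₀).symm x).IsInvertible := by
  have := isInvertible_mfderivWithin_extChartAt_symm (I := 𝓘(ℝ, E)) hx
  rwa [modelWithCornersSelf_coe, Set.range_id, mfderivWithin_univ] at this

theorem contMDiffAt_extChartAt_symm {x₀ : M} {x : E}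
    (hx : x ∈ (extChartAt 𝓘(ℝ, E) x₀).target) :
    ContMDiffAt 𝓘(ℝ, E) 𝓘(ℝ, E) ∞ (extChartAt 𝓘(ℝ, E) x₀).symm x :=
  (contMDiffOn_extChartAt_symm x₀).contMDiffAt ((isOpen_extChartAt_target x₀).mem_nhds hx)

theorem mfderiv_extChartAt_symm_coordField (V : ∀ x : M, TangentSpace 𝓘(ℝ, E) x) {x₀ : M} {x : E}
    (hx : x ∈ (extChartAt 𝓘(ℝ, E) x₀).target) :
    mfderiv 𝓘(ℝ, E) 𝓘(ℝ, E) (extChartAt 𝓘(ℝ, E) x₀).symm x (coordField 𝓘(ℝ, E) V x₀ x : E) =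
      V ((extChartAt 𝓘(ℝ, E) x₀).symm x) := by
  rw [coordField_eq_mpullback]
  exact (isInvertible_mfderiv_extChartAt_symm hx).self_apply_inverse _

theorem contDiffAt_coordField [CompleteSpace E] {V : ∀ x : M, TangentSpace 𝓘(ℝ, E) x}
    (hV : ContMDiff 𝓘(ℝ, E) 𝓘(ℝ, E).tangent ∞ (fun x => (V x : TangentBundle 𝓘(ℝ, E) M)))
    {x₀ : M} {x : E} (hx : x ∈ (extChartAt 𝓘(ℝ, E) x₀).target) :
    ContDiffAt ℝ ∞ (coordField 𝓘(ℝ, E) V x₀) x := by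
  rw [coordField_eq_mpullback]
  have := ContMDiffAt.mpullback_vectorField_preimage (m := ∞) (n := ∞) (hV.contMDiffAt)
    (contMDiffAt_extChartAt_symm hx) (isInvertible_mfderiv_extChartAt_symm hx) (by simp)
  exact contMDiffAt_vectorSpace_iff_contDiffAt.1 this

theorem lieBracket_coordField [CompleteSpace E] {V W : ∀ x : M, TangentSpace 𝓘(ℝ, E) x}
    (hV : ContMDiff 𝓘(ℝ, E) 𝓘(ℝ, E).tangent ∞ (fun x => (V x : TangentBundle 𝓘(ℝ, E) M)))
    (hW : ContMDiff 𝓘(ℝ, E) 𝓘(ℝ, E).tangent ∞ (fun x => (W x : TangentBundle 𝓘(ℝ, E) M)))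
    {x₀ : M} {x : E} (hx : x ∈ (extChartAt 𝓘(ℝ, E) x₀).target) :
    lieBracket ℝ (coordField 𝓘(ℝ, E) V x₀) (coordField 𝓘(ℝ, E) W x₀) x =
      coordField 𝓘(ℝ, E) (mlieBracket 𝓘(ℝ, E) V W) x₀ x := by
  simp only [coordField_eq_mpullback]
  have hM : IsManifold 𝓘(ℝ, E) (minSmoothness ℝ 3) M := by
    simp only [minSmoothness_of_isRCLikeNormedField]
    exact IsManifold.of_le (n := ∞) (WithTop.coe_le_coe.2 le_top)
  have h2 := mpullback_mlieBracket (n := ∞) (hV.mdifferentiable (by simp) _)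
    (hW.mdifferentiable (by simp) _) (contMDiffAt_extChartAt_symm hx)
    (by simpa using two_le_infty)
  rw [← mlieBracketWithin_univ (V := mpullback 𝓘(ℝ, E) 𝓘(ℝ, E) (extChartAt 𝓘(ℝ, E) x₀).symm V),
    mlieBracketWithin_eq_lieBracketWithin] at h2
  exact (congrFun lieBracketWithin_univ x).symm.trans h2.symm

/-- The coordinate change from the chart at `x₀` to the chart at `x₁`. -/
def chartTransition (E : Type*) [NormedAddCommGroup E] [NormedSpace ℝ E]
    {M : Type*} [TopologicalSpace M] [ChartedSpace E M] (x₀ x₁ : M) (x : E) : E :=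
  extChartAt 𝓘(ℝ, E) x₁ ((extChartAt 𝓘(ℝ, E) x₀).symm x)

theorem contDiffAt_chartTransition {x₀ x₁ : M} {x : E} (hx : x ∈ (extChartAt 𝓘(ℝ, E) x₀).target)
    (hx₁ : (extChartAt 𝓘(ℝ, E) x₀).symm x ∈ (extChartAt 𝓘(ℝ, E) x₁).source) :
    ContDiffAt ℝ ∞ (chartTransition E x₀ x₁) x := by
  have h1 := contMDiffAt_extChartAt' (I := 𝓘(ℝ, E)) (n := ∞) (x := x₁)
    (x' := (extChartAt 𝓘(ℝ, E) x₀).symm x) (by simpa using hx₁)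
  exact (h1.comp x (contMDiffAt_extChartAt_symm hx)).contDiffAt

theorem eventually_mem_source {x₀ x₁ : M} {x : E} (hx : x ∈ (extChartAt 𝓘(ℝ, E) x₀).target)
    (hx₁ : (extChartAt 𝓘(ℝ, E) x₀).symm x ∈ (extChartAt 𝓘(ℝ, E) x₁).source) :
    ∀ᶠ x' in 𝓝 x, x' ∈ (extChartAt 𝓘(ℝ, E) x₀).target ∧
      (extChartAt 𝓘(ℝ, E) x₀).symm x' ∈ (extChartAt 𝓘(ℝ, E) x₁).source :=
by
  filter_upwards [(isOpen_extChartAt_target x₀).mem_nhds hx,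
    (contMDiffAt_extChartAt_symm hx).continuousAt ((isOpen_extChartAt_source x₁).mem_nhds hx₁)]
    with x' h h' using ⟨h, h'⟩

theorem coordField_chartTransition (V : ∀ x : M, TangentSpace 𝓘(ℝ, E) x) {x₀ x₁ : M} {x : E}
    (hx : x ∈ (extChartAt 𝓘(ℝ, E) x₀).target)
    (hx₁ : (extChartAt 𝓘(ℝ, E) x₀).symm x ∈ (extChartAt 𝓘(ℝ, E) x₁).source) :
    coordField 𝓘(ℝ, E) V x₁ (chartTransition E x₀ x₁ x) =
      fderiv ℝ (chartTransition E x₀ x₁) x (coordField 𝓘(ℝ, E) V x₀ x) := by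
  have ht : chartTransition E x₀ x₁ x ∈ (extChartAt 𝓘(ℝ, E) x₁).target :=
    (extChartAt 𝓘(ℝ, E) x₁).map_source hx₁
  have hinv : (extChartAt 𝓘(ℝ, E) x₁).symm (chartTransition E x₀ x₁ x) =
      (extChartAt 𝓘(ℝ, E) x₀).symm x := (extChartAt 𝓘(ℝ, E) x₁).left_inv hx₁
  have h1 : mfderiv 𝓘(ℝ, E) 𝓘(ℝ, E) (extChartAt 𝓘(ℝ, E) x₀).symm x =
      (mfderiv 𝓘(ℝ, E) 𝓘(ℝ, E) (extChartAt 𝓘(ℝ, E) x₁).symm (chartTransition E x₀ x₁ x)).comp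
        (mfderiv 𝓘(ℝ, E) 𝓘(ℝ, E) (chartTransition E x₀ x₁) x) := by
    have h2 := mfderiv_comp (I := 𝓘(ℝ, E)) (I' := 𝓘(ℝ, E)) (I'' := 𝓘(ℝ, E)) x
      (((contMDiffAt_extChartAt_symm ht)).mdifferentiableAt (by simp))
      ((contDiffAt_chartTransition hx hx₁).contMDiffAt.mdifferentiableAt (by simp))
    rw [← h2]
    refine Filter.EventuallyEq.mfderiv_eq ?_
    filter_upwards [eventually_mem_source hx hx₁] with x' hx'
    exact ((extChartAt 𝓘(ℝ, E) x₁).left_inv hx'.2).symm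
  have h3 := mfderiv_extChartAt_symm_coordField V ht
  have h4 := mfderiv_extChartAt_symm_coordField V hx
  rw [h1, mfderiv_eq_fderiv] at h4
  have h5 := h3.trans ((congrArg (fun a => (V a : E)) hinv).trans h4.symm)
  exact (isInvertible_mfderiv_extChartAt_symm ht).injective h5

end Charts

/-! ### Complete and vertical lifts in the charts of the tangent bundle -/

section TangentCharts

variable {E : Type*} [NormedAddCommGroup E] [NormedSpace ℝ E]
  {M : Type*} [TopologicalSpace M] [ChartedSpace E M]

theorem mem_extChartAt_tangent_target [IsManifold 𝓘(ℝ, E) 1 M] (p : TangentBundle 𝓘(ℝ, E) M)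
    (x y : E) :
    (x, y) ∈ (extChartAt 𝓘(ℝ, E).tangent p).target ↔ x ∈ (extChartAt 𝓘(ℝ, E) p.proj).target := by
  rw [FiberBundle.extChartAt_target]
  simpa using (chartAt E p.proj).map_target

variable [IsManifold 𝓘(ℝ, E) ∞ M]

theorem tangentCoordChange_eq_fderiv {x₀ x₁ : M} {x : E}
    (hx : x ∈ (extChartAt 𝓘(ℝ, E) x₀).target) :
    tangentCoordChange 𝓘(ℝ, E) x₀ x₁ ((extChartAt 𝓘(ℝ, E) x₀).symm x) =
      fderiv ℝ (chartTransition E x₀ x₁) x := by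
  rw [tangentCoordChange_def, (extChartAt 𝓘(ℝ, E) x₀).right_inv hx, modelWithCornersSelf_coe,
    Set.range_id, fderivWithin_univ]
  rfl

/-- Tangent vectors of `TM` are written in the preferred chart at their own base point, so the
inverse chart becomes `(x, y) ↦ (τ x, dτ_x y)` for the transition `τ`; the second derivative term
comes from its second component. -/
theorem mfderiv_extChartAt_tangent_symm (p₀ : TangentBundle 𝓘(ℝ, E) M) {x : E}
    (hx : x ∈ (extChartAt 𝓘(ℝ, E) p₀.proj).target) (y u v : E) :
    mfderiv 𝓘(ℝ, E × E) 𝓘(ℝ, E).tangent (extChartAt 𝓘(ℝ, E).tangent p₀).symm (x, y) (u, v) =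
      ((fderiv ℝ (chartTransition E p₀.proj ((extChartAt 𝓘(ℝ, E) p₀.proj).symm x)) x u,
        fderiv ℝ (fderiv ℝ
            (chartTransition E p₀.proj ((extChartAt 𝓘(ℝ, E) p₀.proj).symm x))) x u y +
          fderiv ℝ (chartTransition E p₀.proj ((extChartAt 𝓘(ℝ, E) p₀.proj).symm x)) x v) :
        E × E) := by
  set a := (extChartAt 𝓘(ℝ, E) p₀.proj).symm x with ha
  set τ := chartTransition E p₀.proj a with hτ
  have has : a ∈ (extChartAt 𝓘(ℝ, E) a).source := mem_extChartAt_source a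
  have hτC : ContDiffAt ℝ ∞ τ x := contDiffAt_chartTransition hx has
  have hd1 : HasFDerivAt τ (fderiv ℝ τ x) x := (hτC.differentiableAt (by simp)).hasFDerivAt
  have hd2 : HasFDerivAt (fderiv ℝ τ) (fderiv ℝ (fderiv ℝ τ) x) x :=
    (((hτC.of_le two_le_infty).fderiv_right (m := 1) (by norm_num)).differentiableAt
      (by simp)).hasFDerivAt
  have h1 : HasFDerivAt (fun q : E × E => (τ q.1, fderiv ℝ τ q.1 q.2)) _ (x, y) :=
    (HasFDerivAt.comp (g := τ) (x, y) hd1 hasFDerivAt_fst).prodMk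
      ((HasFDerivAt.comp (g := fderiv ℝ τ) (x, y) hd2 hasFDerivAt_fst).clm_apply hasFDerivAt_snd)
  have hcongr : (writtenInExtChartAt 𝓘(ℝ, E × E) 𝓘(ℝ, E).tangent (x, y)
      (extChartAt 𝓘(ℝ, E).tangent p₀).symm) =ᶠ[𝓝 (x, y)]
        fun q : E × E => (τ q.1, fderiv ℝ τ q.1 q.2) := by
    have : ∀ᶠ q : E × E in 𝓝 (x, y), q.1 ∈ (extChartAt 𝓘(ℝ, E) p₀.proj).target ∧
      (extChartAt 𝓘(ℝ, E) p₀.proj).symm q.1 ∈ (extChartAt 𝓘(ℝ, E) a).source :=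
      (continuous_fst.tendsto (x, y)).eventually (eventually_mem_source hx has)
    filter_upwards [this] with q hq
    refine Prod.ext rfl ?_
    -- The fibre coordinate passes through the preferred chart at a moving point; the cocycle
    -- identity removes this intermediate chart.
    change tangentCoordChange 𝓘(ℝ, E) ((extChartAt 𝓘(ℝ, E) p₀.proj).symm q.1) a
      ((extChartAt 𝓘(ℝ, E) p₀.proj).symm q.1) (tangentCoordChange 𝓘(ℝ, E) p₀.proj
        ((extChartAt 𝓘(ℝ, E) p₀.proj).symm q.1) ((extChartAt 𝓘(ℝ, E) p₀.proj).symm q.1) q.2) =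
      fderiv ℝ τ q.1 q.2
    rw [tangentCoordChange_comp, tangentCoordChange_eq_fderiv hq.1]
    exact ⟨⟨(extChartAt 𝓘(ℝ, E) p₀.proj).map_target hq.1, mem_extChartAt_source _⟩, hq.2⟩
  have hM : HasMFDerivAt 𝓘(ℝ, E × E) 𝓘(ℝ, E).tangent (extChartAt 𝓘(ℝ, E).tangent p₀).symm (x, y) _ :=
    ⟨(continuousOn_extChartAt_symm p₀).continuousAt ((isOpen_extChartAt_target p₀).mem_nhds
      ((mem_extChartAt_tangent_target p₀ x y).2 hx)),
      (h1.congr_of_eventuallyEq hcongr).hasFDerivWithinAt⟩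
  rw [hM.mfderiv]
  refine Prod.ext ?_ ?_
  · rfl
  · change fderiv ℝ τ x v + fderiv ℝ (fderiv ℝ τ) x u y = _
    exact add_comm _ _

variable {p₀ : TangentBundle 𝓘(ℝ, E) M} {x : E}

theorem mfderiv_extChartAt_symm_eq {x₀ : M} (hx : x ∈ (extChartAt 𝓘(ℝ, E) x₀).target) (u : E) :
    (mfderiv 𝓘(ℝ, E) 𝓘(ℝ, E) (extChartAt 𝓘(ℝ, E) x₀).symm x u : E) =
      fderiv ℝ (chartTransition E x₀ ((extChartAt 𝓘(ℝ, E) x₀).symm x)) x u := by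
  have h := (contMDiffAt_extChartAt_symm hx).mdifferentiableAt (by simp)
  rw [h.mfderiv, modelWithCornersSelf_coe, Set.range_id, fderivWithin_univ]
  rfl

theorem mfderiv_extChartAt_tangent_symm_verticalLift (V : ∀ x : M, TangentSpace 𝓘(ℝ, E) x)
    (hx : x ∈ (extChartAt 𝓘(ℝ, E) p₀.proj).target) (y : E) :
    mfderiv 𝓘(ℝ, E × E) 𝓘(ℝ, E).tangent (extChartAt 𝓘(ℝ, E).tangent p₀).symm (x, y)
        ((0, coordField 𝓘(ℝ, E) V p₀.proj x) : E × E) =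
      verticalLift 𝓘(ℝ, E) V ((extChartAt 𝓘(ℝ, E).tangent p₀).symm (x, y)) := by
  refine (mfderiv_extChartAt_tangent_symm p₀ hx y _ _).trans ?_
  refine Prod.ext (map_zero _) ?_
  have h1 := mfderiv_extChartAt_symm_coordField V hx
  refine Eq.trans ?_ ((mfderiv_extChartAt_symm_eq hx _).symm.trans h1)
  simp

/-- The coordinate formula for the complete lift is independent of the chart: differentiating the
transformation law `ξ₁ ∘ τ = dτ ξ₀` along `y` produces exactly the second derivative term, up to the
symmetry of `d²τ`. -/
theorem mfderiv_extChartAt_tangent_symm_completeLift [CompleteSpace E]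
    {V : ∀ x : M, TangentSpace 𝓘(ℝ, E) x}
    (hV : ContMDiff 𝓘(ℝ, E) 𝓘(ℝ, E).tangent ∞ (fun x => (V x : TangentBundle 𝓘(ℝ, E) M)))
    (hx : x ∈ (extChartAt 𝓘(ℝ, E) p₀.proj).target) (y : E) :
    mfderiv 𝓘(ℝ, E × E) 𝓘(ℝ, E).tangent (extChartAt 𝓘(ℝ, E).tangent p₀).symm (x, y)
        ((coordField 𝓘(ℝ, E) V p₀.proj x, fderiv ℝ (coordField 𝓘(ℝ, E) V p₀.proj) x y) : E × E) =
      completeLift 𝓘(ℝ, E) V ((extChartAt 𝓘(ℝ, E).tangent p₀).symm (x, y)) := by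
  refine (mfderiv_extChartAt_tangent_symm p₀ hx y _ _).trans ?_
  refine Prod.ext ((mfderiv_extChartAt_symm_eq hx _).symm.trans
    (mfderiv_extChartAt_symm_coordField V hx)) ?_
  set a := (extChartAt 𝓘(ℝ, E) p₀.proj).symm x with ha
  have has : a ∈ (extChartAt 𝓘(ℝ, E) a).source := mem_extChartAt_source a
  change fderiv ℝ (fderiv ℝ (chartTransition E p₀.proj a)) x _ y + _ =
    fderivWithin ℝ (coordField 𝓘(ℝ, E) V a) (Set.range 𝓘(ℝ, E)) (chartTransition E p₀.proj a x)
      (tangentCoordChange 𝓘(ℝ, E) p₀.proj a a y)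
  rw [tangentCoordChange_eq_fderiv hx, modelWithCornersSelf_coe, Set.range_id, fderivWithin_univ]
  set τ := chartTransition E p₀.proj a with hτ
  have hτC : ContDiffAt ℝ ∞ τ x := contDiffAt_chartTransition hx has
  have hd1 : HasFDerivAt τ (fderiv ℝ τ x) x := (hτC.differentiableAt (by simp)).hasFDerivAt
  have hd2 : HasFDerivAt (fderiv ℝ τ) (fderiv ℝ (fderiv ℝ τ) x) x :=
    (((hτC.of_le two_le_infty).fderiv_right (m := 1) (by norm_num)).differentiableAt
      (by simp)).hasFDerivAt
  have hd3 : HasFDerivAt (coordField 𝓘(ℝ, E) V p₀.proj) _ x :=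
    ((contDiffAt_coordField hV hx).differentiableAt (by simp)).hasFDerivAt
  have hd4 : HasFDerivAt (coordField 𝓘(ℝ, E) V a) _ (τ x) :=
    ((contDiffAt_coordField hV ((extChartAt 𝓘(ℝ, E) a).map_source has)).differentiableAt
      (by simp)).hasFDerivAt
  have h5 : (fun x' => coordField 𝓘(ℝ, E) V a (τ x')) =ᶠ[𝓝 x]
      fun x' => fderiv ℝ τ x' (coordField 𝓘(ℝ, E) V p₀.proj x') := by
    filter_upwards [eventually_mem_source hx has] with x' hx'
    exact coordField_chartTransition V hx'.1 hx'.2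
  have h6 := (hd4.comp x hd1).unique ((hd2.clm_apply hd3).congr_of_eventuallyEq h5)
  have h7 := DFunLike.congr_fun h6 y
  simp only [ContinuousLinearMap.comp_apply, add_apply, ContinuousLinearMap.flip_apply] at h7
  refine Eq.trans ?_ h7.symm
  rw [(hτC.isSymmSndFDerivAt (by simpa using two_le_infty)).eq, add_comm]

end TangentCharts

/-! ### Prolongation of a frame and its brackets -/

section ProlongedFrames

variable {V : Type*} [NormedAddCommGroup V] [NormedSpace ℝ V]
  {W : Type*} [NormedAddCommGroup W] [NormedSpace ℝ W]

/-- The frame of complete and vertical lifts of a frame. -/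
def prolongFrame (e : V → W →L[ℝ] V) (q : V × V) : W × W →L[ℝ] V × V :=
  ((e q.1).comp (.fst ℝ W W)).prod
    ((fderiv ℝ e q.1 q.2).comp (.fst ℝ W W) + (e q.1).comp (.snd ℝ W W))

theorem prolongFrame_apply (e : V → W →L[ℝ] V) (q : V × V) (w : W × W) :
    prolongFrame e q w = (e q.1 w.1, fderiv ℝ e q.1 q.2 w.1 + e q.1 w.2) := rfl

variable {e : V → W →L[ℝ] V} {x : V}

/-- The map is block triangular with `e x` twice on the diagonal. -/
theorem isInvertible_prolongFrame (h : (e x).IsInvertible) (y : V) :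
    (prolongFrame e (x, y)).IsInvertible := by
  refine ContinuousLinearMap.IsInvertible.of_inverse
    (g := ((e x).inverse.comp (.fst ℝ V V)).prod ((e x).inverse.comp
      (.snd ℝ V V - (fderiv ℝ e x y).comp ((e x).inverse.comp (.fst ℝ V V))))) ?_ ?_
  · ext v <;> simp [prolongFrame_apply, h.self_apply_inverse]
  · ext w <;> simp [prolongFrame_apply, h.inverse_apply_self]

theorem contDiffAt_prolongFrame (he : ContDiffAt ℝ ∞ e x) (y : V) :
    ContDiffAt ℝ 2 (prolongFrame e) (x, y) := by
  have h1 : ContDiffAt ℝ 2 (fun q : V × V => e q.1) (x, y) :=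
    ContDiffAt.comp (x, y) (he.of_le two_le_infty) contDiffAt_fst
  have h2 : ContDiffAt ℝ 2 (fun q : V × V => fderiv ℝ e q.1) (x, y) :=
    ContDiffAt.comp (g := fderiv ℝ e) (x, y) (he.fderiv_right (WithTop.coe_le_coe.2 le_top))
      contDiffAt_fst
  have h3 : ContDiffAt ℝ 2 (fun q : V × V => ContinuousLinearMap.inl ℝ V V ∘L
      ((e q.1).comp (.fst ℝ W W)) + ContinuousLinearMap.inr ℝ V V ∘L
      ((fderiv ℝ e q.1 q.2).comp (.fst ℝ W W) + (e q.1).comp (.snd ℝ W W))) (x, y) := by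
    exact (contDiffAt_const.clm_comp (h1.clm_comp contDiffAt_const)).add
      (contDiffAt_const.clm_comp (((h2.clm_apply contDiffAt_snd).clm_comp contDiffAt_const).add
        (h1.clm_comp contDiffAt_const)))
  convert h3 using 2 with q
  ext w <;> simp [prolongFrame_apply]

set_option maxSynthPendingDepth 3 in
-- These are the bracket relations of complete and vertical lifts. The second component is the
-- derivative along `y` of the bracket identity of `e`, which is why that identity is needed on a
-- neighbourhood.
theorem prolongFrame_bracket (he : ContDiffAt ℝ ∞ e x) {c : W → W → W}
    (hc : ∀ᶠ x' in 𝓝 x, ∀ w η,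
      e x' (c w η) = fderiv ℝ e x' (e x' w) η - fderiv ℝ e x' (e x' η) w)
    (y : V) (w η : W × W) :
    prolongFrame e (x, y) (c w.1 η.1, c w.1 η.2 + c w.2 η.1) =
      fderiv ℝ (prolongFrame e) (x, y) (prolongFrame e (x, y) w) η -
        fderiv ℝ (prolongFrame e) (x, y) (prolongFrame e (x, y) η) w := by
  have hd1 : HasFDerivAt e (fderiv ℝ e x) x := (he.differentiableAt (by simp)).hasFDerivAt
  have hd2 : HasFDerivAt (fderiv ℝ e) (fderiv ℝ (fderiv ℝ e) x) x :=
    (((he.of_le two_le_infty).fderiv_right (m := 1) (by norm_num)).differentiableAt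
      (by simp)).hasFDerivAt
  have hP : ∀ (η : W × W) (u v : V), fderiv ℝ (prolongFrame e) (x, y) (u, v) η =
      (fderiv ℝ e x u η.1, fderiv ℝ (fderiv ℝ e) x u y η.1 + fderiv ℝ e x v η.1 +
        fderiv ℝ e x u η.2) := by
    intro η u v
    have h1 := (((contDiffAt_prolongFrame he y).differentiableAt (by simp)).hasFDerivAt.clm_apply
      (hasFDerivAt_const η (x, y)))
    have hf : HasFDerivAt (fun q : V × V => e q.1) _ (x, y) :=
      HasFDerivAt.comp (g := e) (x, y) hd1 hasFDerivAt_fst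
    have hf' : HasFDerivAt (fun q : V × V => fderiv ℝ e q.1)
        ((fderiv ℝ (fderiv ℝ e) x).comp (.fst ℝ V V)) (x, y) :=
      HasFDerivAt.comp (g := fderiv ℝ e) (f := Prod.fst) (x, y) hd2 hasFDerivAt_fst
    have hff : HasFDerivAt (fun q : V × V => fderiv ℝ e q.1 q.2) _ (x, y) :=
      hf'.clm_apply hasFDerivAt_snd
    have h2 : HasFDerivAt (fun q : V × V => (e q.1 η.1, fderiv ℝ e q.1 q.2 η.1 + e q.1 η.2)) _
        (x, y) := (hf.clm_apply (hasFDerivAt_const η.1 (x, y))).prodMk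
      ((hff.clm_apply (hasFDerivAt_const η.1 (x, y))).add
        (hf.clm_apply (hasFDerivAt_const η.2 (x, y))))
    have h3 := DFunLike.congr_fun (h1.unique h2) (u, v)
    simp at h3
    rw [h3]
    simp [add_comm]
  have hkey : ∀ w η, fderiv ℝ e x y (c w η) =
      fderiv ℝ (fderiv ℝ e) x y (e x w) η + fderiv ℝ e x (fderiv ℝ e x y w) η -
      (fderiv ℝ (fderiv ℝ e) x y (e x η) w + fderiv ℝ e x (fderiv ℝ e x y η) w) := by
    intro w η
    have hh : ∀ w η : W, HasFDerivAt (fun x' => fderiv ℝ e x' (e x' w) η) _ x := fun w η =>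
      (hd2.clm_apply (hd1.clm_apply (hasFDerivAt_const w x))).clm_apply (hasFDerivAt_const η x)
    have h1 := (hd1.clm_apply (hasFDerivAt_const (c w η) x)).unique
      (((hh w η).sub (hh η w)).congr_of_eventuallyEq (hc.mono fun x' h => h w η))
    have h2 := DFunLike.congr_fun h1 y
    simp at h2
    rw [h2]
    abel
  have hsymm : IsSymmSndFDerivAt ℝ e x := he.isSymmSndFDerivAt (by simpa using two_le_infty)
  have hc0 := hc.self_of_nhds
  rw [prolongFrame_apply e (x, y) w, prolongFrame_apply e (x, y) η, hP, hP, prolongFrame_apply]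
  refine Prod.ext ?_ ?_
  · exact hc0 _ _
  · simp only [Prod.snd_sub, map_add, add_apply, hkey, hc0]
    rw [hsymm.eq y (e x w.1), hsymm.eq y (e x η.1)]
    abel

end ProlongedFrames

/-! ### Smoothness of left invariant fields -/

section LeftInvariantFields

variable {E : Type*} [NormedAddCommGroup E] [NormedSpace ℝ E]
  {G : Type*} [TopologicalSpace G] [ChartedSpace E G] [Group G] [LieGroup 𝓘(ℝ, E) ∞ G]

/-- The field is `x ↦ (0_x, v)` followed by the tangent map of the multiplication. -/
theorem contMDiff_infty_mulInvariantVectorField (v : GroupLieAlgebra 𝓘(ℝ, E) G) :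
    ContMDiff 𝓘(ℝ, E) 𝓘(ℝ, E).tangent ∞
      (fun x : G => (mulInvariantVectorField v x : TangentBundle 𝓘(ℝ, E) G)) := by
  let fg : G → TangentBundle 𝓘(ℝ, E) G := fun g => Bundle.TotalSpace.mk' E g 0
  have sfg : ContMDiff 𝓘(ℝ, E) 𝓘(ℝ, E).tangent ∞ fg := Bundle.contMDiff_zeroSection _ _
  let fv : G → TangentBundle 𝓘(ℝ, E) G := fun _ => Bundle.TotalSpace.mk' E 1 v
  have sfv : ContMDiff 𝓘(ℝ, E) 𝓘(ℝ, E).tangent ∞ fv := contMDiff_const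
  let F₁ : G → (TangentBundle 𝓘(ℝ, E) G × TangentBundle 𝓘(ℝ, E) G) := fun g => (fg g, fv g)
  have S₁ : ContMDiff 𝓘(ℝ, E) (𝓘(ℝ, E).tangent.prod 𝓘(ℝ, E).tangent) ∞ F₁ := sfg.prodMk sfv
  let F₂ : (TangentBundle 𝓘(ℝ, E) G × TangentBundle 𝓘(ℝ, E) G) →
      TangentBundle (𝓘(ℝ, E).prod 𝓘(ℝ, E)) (G × G) :=
    (equivTangentBundleProd 𝓘(ℝ, E) G 𝓘(ℝ, E) G).symm
  have S₂ : ContMDiff (𝓘(ℝ, E).tangent.prod 𝓘(ℝ, E).tangent) (𝓘(ℝ, E).prod 𝓘(ℝ, E)).tangent ∞ F₂ :=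
    contMDiff_equivTangentBundleProd_symm
  let F₃ : TangentBundle (𝓘(ℝ, E).prod 𝓘(ℝ, E)) (G × G) → TangentBundle 𝓘(ℝ, E) G :=
    tangentMap (𝓘(ℝ, E).prod 𝓘(ℝ, E)) 𝓘(ℝ, E) (fun (p : G × G) => p.1 * p.2)
  have S₃ : ContMDiff (𝓘(ℝ, E).prod 𝓘(ℝ, E)).tangent 𝓘(ℝ, E).tangent ∞ F₃ :=
    (contMDiff_mul 𝓘(ℝ, E) ∞).contMDiff_tangentMap (m := ∞) (by simp)
  have S := (S₃.comp S₂).comp S₁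
  refine S.congr fun x => ?_
  have hd : MDifferentiableAt (𝓘(ℝ, E).prod 𝓘(ℝ, E)) 𝓘(ℝ, E) (fun p : G × G => p.1 * p.2) (x, 1) :=
    (contMDiff_mul 𝓘(ℝ, E) ∞).mdifferentiable (by simp) _
  have h1 : mfderiv (𝓘(ℝ, E).prod 𝓘(ℝ, E)) 𝓘(ℝ, E) (fun p : G × G => p.1 * p.2) (x, 1)
      ((0 : E), (v : E)) = (mfderiv 𝓘(ℝ, E) 𝓘(ℝ, E) (x * ·) 1 v : E) := by
    refine (mfderiv_prod_eq_add_apply hd).trans ?_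
    let z₀ : E := mfderiv 𝓘(ℝ, E) 𝓘(ℝ, E) (x * ·) 1 v
    exact (congrArg (fun z : E => z + z₀) (map_zero _)).trans (zero_add z₀)
  change (⟨x, mfderiv 𝓘(ℝ, E) 𝓘(ℝ, E) (x * ·) 1 v⟩ : TangentBundle 𝓘(ℝ, E) G) =
    ⟨x * 1, mfderiv (𝓘(ℝ, E).prod 𝓘(ℝ, E)) 𝓘(ℝ, E) (fun p : G × G => p.1 * p.2) (x, 1)
      ((0 : E), (v : E))⟩
  rw [h1]
  congr 1
  exact (mul_one x).symm

end LeftInvariantFields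

/-! ### The left invariant frame and its prolongation -/

section LieGroupFrames

variable {E : Type*} [NormedAddCommGroup E] [NormedSpace ℝ E]
  {G : Type*} [TopologicalSpace G] [ChartedSpace E G] [Group G] [LieGroup 𝓘(ℝ, E) ∞ G]

/-- The left invariant vector fields in the chart at `x₀`. -/
def leftFrame (x₀ : G) (x : E) : E →L[ℝ] E :=
  ContinuousLinearMap.comp (M₂ := E)
    (mfderiv 𝓘(ℝ, E) 𝓘(ℝ, E) (extChartAt 𝓘(ℝ, E) x₀).symm x).inverse
    (mfderiv 𝓘(ℝ, E) 𝓘(ℝ, E) ((extChartAt 𝓘(ℝ, E) x₀).symm x * ·) (1 : G))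

omit [LieGroup 𝓘(ℝ, E) ∞ G] in
theorem leftFrame_apply (x₀ : G) (x : E) (Y : GroupLieAlgebra 𝓘(ℝ, E) G) :
    leftFrame x₀ x (Y : E) = coordField 𝓘(ℝ, E) (mulInvariantVectorField Y) x₀ x := by
  rw [coordField_eq_mpullback]; rfl

/-- The inner product of the Lie algebra, as a form on the model space. -/
def modelInner (g : RiemannianMetricOn E G) : E →L[ℝ] E →L[ℝ] ℝ := g.inner 1

theorem modelInner_symm (g : RiemannianMetricOn E G) (v w : E) :
    modelInner g v w = modelInner g w v := g.symm 1 v w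

theorem modelInner_pos (g : RiemannianMetricOn E G) (v : E) (hv : v ≠ 0) :
    0 < modelInner g v v := g.pos 1 v hv

theorem inner_mulInvariantVectorField {g : RiemannianMetricOn E G} (hg : IsLeftInvariant g)
    (x : G) (Y Z : GroupLieAlgebra 𝓘(ℝ, E) G) :
    g.inner x (mulInvariantVectorField Y x) (mulInvariantVectorField Z x) = g.inner 1 Y Z := by
  -- Left translation lands in the tangent space at `x * 1`; the equality `x * 1 = x` is transported
  -- through the common model space.
  have h : ∀ (b : G) (_ : b = x) (v w : E), g.inner b v w = g.inner x v w := by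
    rintro b rfl v w; rfl
  exact (h (x * 1) (mul_one x) _ _).symm.trans (hg x 1 Y Z)

variable {x₀ : G} {x : E}

theorem isInvertible_leftFrame (hx : x ∈ (extChartAt 𝓘(ℝ, E) x₀).target) :
    (leftFrame x₀ x).IsInvertible :=
  ContinuousLinearMap.IsInvertible.comp (M₂ := E)
    (isInvertible_mfderiv_extChartAt_symm hx).inverse (isInvertible_mfderiv_mul_left _)

theorem contDiffAt_leftFrame [FiniteDimensional ℝ E]
    (hx : x ∈ (extChartAt 𝓘(ℝ, E) x₀).target) : ContDiffAt ℝ ∞ (leftFrame (E := E) x₀) x := by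
  have : CompleteSpace E := FiniteDimensional.complete ℝ E
  have h : ContDiffOn ℝ ∞ (leftFrame (E := E) x₀) (extChartAt 𝓘(ℝ, E) x₀).target := by
    rw [contDiffOn_clm_apply]
    intro Y x hx
    refine ContDiffAt.contDiffWithinAt ?_
    have h := contDiffAt_coordField (contMDiff_infty_mulInvariantVectorField (G := G) Y) hx
    exact h.congr_of_eventuallyEq (Filter.Eventually.of_forall fun x' => leftFrame_apply x₀ x' Y)
  exact h.contDiffAt ((isOpen_extChartAt_target x₀).mem_nhds hx)

theorem leftFrame_bracket [FiniteDimensional ℝ E]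
    (hx : x ∈ (extChartAt 𝓘(ℝ, E) x₀).target) (Y Z : GroupLieAlgebra 𝓘(ℝ, E) G) :
    leftFrame x₀ x (⁅Y, Z⁆ : GroupLieAlgebra 𝓘(ℝ, E) G) =
      fderiv ℝ (leftFrame x₀) x (leftFrame x₀ x Y) (Z : E) -
        fderiv ℝ (leftFrame x₀) x (leftFrame x₀ x Z) (Y : E) := by
  have : CompleteSpace E := FiniteDimensional.complete ℝ E
  have hG : LieGroup 𝓘(ℝ, E) (minSmoothness ℝ 3) G := by
    simp only [minSmoothness_of_isRCLikeNormedField]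
    exact LieGroup.of_le (n := ∞) (WithTop.coe_le_coe.2 le_top)
  have hd : HasFDerivAt (leftFrame (E := E) x₀) _ x :=
    ((contDiffAt_leftFrame hx).differentiableAt (by simp)).hasFDerivAt
  have h1 : ∀ Y u : E, fderiv ℝ (fun x' => leftFrame x₀ x' Y) x u =
      fderiv ℝ (leftFrame x₀) x u Y := by
    intro Y u
    rw [(hd.clm_apply (hasFDerivAt_const Y x)).fderiv]; simp
  have h2 := lieBracket_coordField (contMDiff_infty_mulInvariantVectorField Y)
    (contMDiff_infty_mulInvariantVectorField Z) hx
  rw [← mulInvariantVector_mlieBracket] at h2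
  have h3 : ∀ Y : GroupLieAlgebra 𝓘(ℝ, E) G, coordField 𝓘(ℝ, E) (mulInvariantVectorField Y) x₀ =
      fun x' : E => leftFrame x₀ x' (Y : E) := fun Y => funext fun x' => (leftFrame_apply x₀ x' Y).symm
  rw [h3, h3, lieBracket_eq] at h2
  rw [leftFrame_apply]
  refine h2.symm.trans ?_
  exact congrArg₂ (· - ·) (h1 _ _) (h1 _ _)

theorem energyInChart_baseMetric {g : RiemannianMetricOn E G} (hg : IsLeftInvariant g)
    (φ : ℝ → ℝ) (X Y : GroupLieAlgebra 𝓘(ℝ, E) G) (hx : x ∈ (extChartAt 𝓘(ℝ, E) x₀).target) :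
    energyInChart 𝓘(ℝ, E) (baseMetric φ g X) x₀ x (leftFrame x₀ x (Y : E)) =
      alphaBetaEnergy (W := E) φ (modelInner g) X Y := by
  have h1 : (mfderiv 𝓘(ℝ, E) 𝓘(ℝ, E) (extChartAt 𝓘(ℝ, E) x₀).symm x (leftFrame x₀ x (Y : E) : E)) =
      mulInvariantVectorField Y ((extChartAt 𝓘(ℝ, E) x₀).symm x) := by
    rw [leftFrame_apply]
    exact mfderiv_extChartAt_symm_coordField _ hx
  have h2 := inner_mulInvariantVectorField hg ((extChartAt 𝓘(ℝ, E) x₀).symm x) Y Y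
  have h3 := inner_mulInvariantVectorField hg ((extChartAt 𝓘(ℝ, E) x₀).symm x) X Y
  unfold energyInChart
  rw [h1]
  simp only [baseMetric, alphaBetaMetric, h2, h3]
  rfl

/-- The lifted inner product on `𝔤 × 𝔤`. -/
def liftedInner (g : RiemannianMetricOn E G) : E × E →L[ℝ] E × E →L[ℝ] ℝ :=
  (modelInner g).bilinearComp (.fst ℝ E E) (.fst ℝ E E) +
    (modelInner g).bilinearComp (.snd ℝ E E) (.snd ℝ E E)

theorem liftedInner_apply (g : RiemannianMetricOn E G) (v w : E × E) :
    liftedInner g v w = modelInner g v.1 w.1 + modelInner g v.2 w.2 := rfl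

theorem liftedInner_symm (g : RiemannianMetricOn E G) (v w : E × E) :
    liftedInner g v w = liftedInner g w v := by
  rw [liftedInner_apply, liftedInner_apply, modelInner_symm, modelInner_symm g v.2]

theorem modelInner_nonneg (g : RiemannianMetricOn E G) (v : E) : 0 ≤ modelInner g v v := by
  by_cases h : v = 0
  · simp [h]
  · exact (modelInner_pos g v h).le

theorem liftedInner_pos (g : RiemannianMetricOn E G) (v : E × E) (hv : v ≠ 0) :
    0 < liftedInner g v v := by
  rw [liftedInner_apply]
  by_cases h : v.1 = 0
  · have h2 : v.2 ≠ 0 := fun h2 => hv (Prod.ext h h2)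
    linarith [modelInner_pos g _ h2, modelInner_nonneg g v.1]
  · linarith [modelInner_pos g _ h, modelInner_nonneg g v.2]

theorem completePart_add (p : TangentBundle 𝓘(ℝ, E) G) (Y Z : GroupLieAlgebra 𝓘(ℝ, E) G) :
    completePart p (completeLift 𝓘(ℝ, E) (mulInvariantVectorField Y) p +
      verticalLift 𝓘(ℝ, E) (mulInvariantVectorField Z) p) = Y := by
  refine Eq.trans ?_ (completePart_completeLift Y p)
  exact congrArg (toLieAlgebra p.proj) (add_zero (mulInvariantVectorField Y p.proj : E))

theorem verticalPart_add (p : TangentBundle 𝓘(ℝ, E) G) (Y Z : GroupLieAlgebra 𝓘(ℝ, E) G) :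
    verticalPart p (completeLift 𝓘(ℝ, E) (mulInvariantVectorField Y) p +
      verticalLift 𝓘(ℝ, E) (mulInvariantVectorField Z) p) = Z := by
  unfold verticalPart
  rw [completePart_add, add_sub_cancel_left]
  exact toLieAlgebra_mulInvariantVectorField Z p.proj

theorem mfderiv_extChartAt_tangent_symm_prolongFrame [FiniteDimensional ℝ E]
    {p₀ : TangentBundle 𝓘(ℝ, E) G} (hx : x ∈ (extChartAt 𝓘(ℝ, E) p₀.proj).target) (y : E)
    (Y Z : GroupLieAlgebra 𝓘(ℝ, E) G) :
    mfderiv 𝓘(ℝ, E × E) 𝓘(ℝ, E).tangent (extChartAt 𝓘(ℝ, E).tangent p₀).symm (x, y)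
        (prolongFrame (leftFrame p₀.proj) (x, y) ((Y : E), (Z : E)) : E × E) =
      completeLift 𝓘(ℝ, E) (mulInvariantVectorField Y)
          ((extChartAt 𝓘(ℝ, E).tangent p₀).symm (x, y)) +
        verticalLift 𝓘(ℝ, E) (mulInvariantVectorField Z)
          ((extChartAt 𝓘(ℝ, E).tangent p₀).symm (x, y)) := by
  have : CompleteSpace E := FiniteDimensional.complete ℝ E
  have hd : HasFDerivAt (leftFrame (E := E) p₀.proj) _ x :=
    ((contDiffAt_leftFrame hx).differentiableAt (by simp)).hasFDerivAt
  have h0 : coordField 𝓘(ℝ, E) (mulInvariantVectorField Y) p₀.proj =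
      fun x' : E => leftFrame p₀.proj x' (Y : E) :=
    funext fun x' => (leftFrame_apply _ _ _).symm
  have h1 : fderiv ℝ (coordField 𝓘(ℝ, E) (mulInvariantVectorField Y) p₀.proj) x y =
      fderiv ℝ (leftFrame p₀.proj) x y (Y : E) := by
    rw [h0, (hd.clm_apply (hasFDerivAt_const (F := E) Y x)).fderiv]; simp; rfl
  have h2 : prolongFrame (leftFrame p₀.proj) (x, y) ((Y : E), (Z : E)) =
      (coordField 𝓘(ℝ, E) (mulInvariantVectorField Y) p₀.proj x,
        fderiv ℝ (coordField 𝓘(ℝ, E) (mulInvariantVectorField Y) p₀.proj) x y) +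
      ((0 : E), coordField 𝓘(ℝ, E) (mulInvariantVectorField Z) p₀.proj x) := by
    rw [prolongFrame_apply, h1, ← leftFrame_apply, ← leftFrame_apply, Prod.mk_add_mk, add_zero]
  rw [← mfderiv_extChartAt_tangent_symm_completeLift (contMDiff_infty_mulInvariantVectorField _) hx,
    ← mfderiv_extChartAt_tangent_symm_verticalLift _ hx, h2]
  exact map_add _ _ _

/-- The energy of `F^v` has constant coefficients in the prolonged frame, with `X^v` represented by
`(0, X)`. The left invariance of `g` plays no role, since the lifted metric is defined through its
values at the identity. -/
theorem energyInChart_verticalLiftMetric [FiniteDimensional ℝ E] (g : RiemannianMetricOn E G)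
    (φ : ℝ → ℝ) (X Y Z : GroupLieAlgebra 𝓘(ℝ, E) G) {p₀ : TangentBundle 𝓘(ℝ, E) G}
    (hx : x ∈ (extChartAt 𝓘(ℝ, E) p₀.proj).target) (y : E) :
    energyInChart 𝓘(ℝ, E).tangent (verticalLiftMetric φ g X) p₀ (x, y)
        (prolongFrame (leftFrame p₀.proj) (x, y) ((Y : E), (Z : E))) =
      alphaBetaEnergy (W := E × E) φ (liftedInner g) ((0 : E), (X : E)) ((Y : E), (Z : E)) := by
  unfold energyInChart
  rw [mfderiv_extChartAt_tangent_symm_prolongFrame hx]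
  simp only [verticalLiftMetric, alphaBetaMetric, liftedMetric, completePart_add, verticalPart_add,
    completePart_verticalLift, verticalPart_verticalLift]
  rfl

end LieGroupFrames

/-! ### Berwald type in terms of the Lie algebra -/

section Berwald

variable {E : Type*} [NormedAddCommGroup E] [NormedSpace ℝ E] [FiniteDimensional ℝ E]
  {G : Type*} [TopologicalSpace G] [ChartedSpace E G] [Group G] [LieGroup 𝓘(ℝ, E) ∞ G]

variable (E G) in
/-- The bracket of the Lie algebra, as an operation on the model space. -/
def modelBracket (Y Z : E) : E :=
  @Bracket.bracket (GroupLieAlgebra 𝓘(ℝ, E) G) (GroupLieAlgebra 𝓘(ℝ, E) G) _ Y Z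

variable (E G) in
/-- The bracket of the complete and vertical lifts of left invariant vector fields. -/
def liftedBracket (w η : E × E) : E × E :=
  (modelBracket E G w.1 η.1, modelBracket E G w.1 η.2 + modelBracket E G w.2 η.1)

theorem lieGroup_minSmoothness (E G : Type*) [NormedAddCommGroup E] [NormedSpace ℝ E]
    [TopologicalSpace G] [ChartedSpace E G] [Group G] [LieGroup 𝓘(ℝ, E) ∞ G] :
    LieGroup 𝓘(ℝ, E) (minSmoothness ℝ 3) G := by
  simp only [minSmoothness_of_isRCLikeNormedField]
  exact LieGroup.of_le (n := ∞) (WithTop.coe_le_coe.2 le_top)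

theorem bracket_skew (Y Z : GroupLieAlgebra 𝓘(ℝ, E) G) : ⁅Y, Z⁆ = -⁅Z, Y⁆ := by
  have := lieGroup_minSmoothness E G
  have : CompleteSpace E := FiniteDimensional.complete ℝ E
  exact (lie_skew Y Z).symm

theorem zero_bracket (Y : GroupLieAlgebra 𝓘(ℝ, E) G) :
    ⁅(0 : GroupLieAlgebra 𝓘(ℝ, E) G), Y⁆ = 0 := by
  have := lieGroup_minSmoothness E G
  have : CompleteSpace E := FiniteDimensional.complete ℝ E
  exact zero_lie Y

theorem modelBracket_zero_left (Y : E) : modelBracket E G 0 Y = 0 :=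
  zero_bracket (G := G) Y

theorem modelBracket_zero_right (Y : E) : modelBracket E G Y 0 = 0 := by
  have := lieGroup_minSmoothness E G
  have : CompleteSpace E := FiniteDimensional.complete ℝ E
  exact lie_zero (L := GroupLieAlgebra 𝓘(ℝ, E) G) (M := GroupLieAlgebra 𝓘(ℝ, E) G) Y

theorem bracket_smul_smul (a b : ℝ) (Y : GroupLieAlgebra 𝓘(ℝ, E) G) : ⁅a • Y, b • Y⁆ = 0 := by
  have := lieGroup_minSmoothness E G
  have : CompleteSpace E := FiniteDimensional.complete ℝ E
  rw [smul_lie, lie_smul, lie_self, smul_zero, smul_zero]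

variable {g : RiemannianMetricOn E G} {φ : ℝ → ℝ} {b₀ : ℝ} {X : GroupLieAlgebra 𝓘(ℝ, E) G}

omit [FiniteDimensional ℝ E] in
theorem liftedInner_zero_left (g : RiemannianMetricOn E G) (Z : E) (w : E × E) :
    liftedInner g (0, Z) w = modelInner g Z w.2 := by
  simp [liftedInner_apply]

omit [FiniteDimensional ℝ E] [Group G] [LieGroup 𝓘(ℝ, E) ∞ G] in
theorem eventually_mem_tangent_target {p₀ : TangentBundle 𝓘(ℝ, E) G} {x : E}
    (hx : x ∈ (extChartAt 𝓘(ℝ, E) p₀.proj).target) (y : E) :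
    ∀ᶠ q : E × E in 𝓝 (x, y), q.1 ∈ (extChartAt 𝓘(ℝ, E) p₀.proj).target :=
  (continuous_fst.tendsto (x, y)).eventually ((isOpen_extChartAt_target p₀.proj).mem_nhds hx)

theorem isBerwald_verticalLiftMetric_of_central (hφ : IsAlphaBetaFunction φ b₀)
    (hX : √(g.inner 1 X X) < b₀) (h1 : ∀ Y Z : GroupLieAlgebra 𝓘(ℝ, E) G, g.inner 1 X ⁅Y, Z⁆ = 0)
    (h2 : ∀ Y : GroupLieAlgebra 𝓘(ℝ, E) G, ⁅X, Y⁆ = 0) :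
    IsBerwald 𝓘(ℝ, E).tangent (verticalLiftMetric φ g X) := by
  intro p₀
  -- Berwald type imposes no regularity on `Γ` in the base point, so it may be chosen point by
  -- point, with the value `0` outside the chart.
  have key : ∀ q : E × E, ∃ Γ : E × E →L[ℝ] E × E →L[ℝ] E × E,
      q ∈ (extChartAt 𝓘(ℝ, E).tangent p₀).target → ∀ v, v ≠ 0 →
        sprayCoefficients (energyInChart 𝓘(ℝ, E).tangent (verticalLiftMetric φ g X) p₀) q v =
          (1 / 2 : ℝ) • Γ v v := by
    rintro ⟨x, y⟩
    by_cases hq : (x, y) ∈ (extChartAt 𝓘(ℝ, E).tangent p₀).target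
    swap
    · exact ⟨0, fun h => absurd h hq⟩
    have hx := (mem_extChartAt_tangent_target p₀ x y).1 hq
    obtain ⟨Γ, hΓ⟩ := exists_sprayCoefficients_eq_of_parallel (B := liftedInner g)
      (X := ((0 : E), (X : E))) (c := liftedBracket E G) (e := prolongFrame (leftFrame p₀.proj))
      (x := (x, y)) (L := energyInChart 𝓘(ℝ, E).tangent (verticalLiftMetric φ g X) p₀)
      (liftedInner_symm g) (liftedInner_pos g) hφ
      (lt_of_eq_of_lt (congrArg Real.sqrt (liftedInner_zero_left g X (0, X))) hX)
      (contDiffAt_prolongFrame (contDiffAt_leftFrame hx) y)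
      (isInvertible_prolongFrame (isInvertible_leftFrame hx) y)
      ((eventually_mem_tangent_target hx y).mono fun q hq η =>
        energyInChart_verticalLiftMetric g φ X η.1 η.2 hq q.2)
      (prolongFrame_bracket (contDiffAt_leftFrame hx) (by
        filter_upwards [(isOpen_extChartAt_target p₀.proj).mem_nhds hx] with x' hx' w η
        exact leftFrame_bracket hx' w η) y)
      (by
        intro w η
        exact (liftedInner_zero_left g X _).trans ((map_add (modelInner g X) _ _).trans
          ((congrArg₂ (· + ·) (h1 w.1 η.2) (h1 w.2 η.1)).trans (add_zero 0))))
      (by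
        have h0 : ∀ w : E × E, liftedBracket E G ((0 : E), (X : E)) w = 0 := by
          intro w
          refine Prod.ext (zero_bracket w.1) ?_
          exact (congrArg₂ (· + ·) (zero_bracket w.2) (h2 w.1)).trans (add_zero 0)
        intro w η
        rw [h0, h0]; simp)
    exact ⟨Γ, fun _ => hΓ⟩
  choose Γ hΓ using key
  exact ⟨Γ, hΓ⟩

theorem central_of_isBerwald_verticalLiftMetric (hφ : IsAlphaBetaFunction φ b₀)
    (hX : √(g.inner 1 X X) < b₀) (hX0 : X ≠ 0)
    (hRiem : ¬ ∃ c₁ c₂ : ℝ, ∀ s : ℝ, |s| ≤ √(g.inner 1 X X) → φ s ^ 2 = c₁ + c₂ * s ^ 2)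
    (h : IsBerwald 𝓘(ℝ, E).tangent (verticalLiftMetric φ g X)) :
    (∀ Y Z : GroupLieAlgebra 𝓘(ℝ, E) G, g.inner 1 X ⁅Y, Z⁆ = 0) ∧
      ∀ Y : GroupLieAlgebra 𝓘(ℝ, E) G, ⁅X, Y⁆ = 0 := by
  let p₀ : TangentBundle 𝓘(ℝ, E) G := ⟨1, 0⟩
  obtain ⟨Γ, hΓ⟩ := h p₀
  obtain ⟨x, hx⟩ : ∃ x, x ∈ (extChartAt 𝓘(ℝ, E) p₀.proj).target := ⟨_, mem_extChartAt_target _⟩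
  have hb : liftedInner g ((0 : E), (X : E)) ((0 : E), (X : E)) = g.inner 1 X X :=
    liftedInner_zero_left g _ _
  have hX0' : (X : E) ≠ (0 : E) := hX0
  obtain ⟨h1, h2⟩ := parallel_of_exists_sprayCoefficients_eq (B := liftedInner g)
      (X := ((0 : E), (X : E))) (c := liftedBracket E G) (e := prolongFrame (leftFrame p₀.proj))
      (x := (x, 0)) (L := energyInChart 𝓘(ℝ, E).tangent (verticalLiftMetric φ g X) p₀)
      -- The complete lift of `X` is a nonzero vector orthogonal to `X^v`, so no condition on the
      -- dimension of `G` is needed.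
      (f := ((X : E), (0 : E)))
      (liftedInner_symm g) (liftedInner_pos g) hφ
      (lt_of_eq_of_lt (congrArg Real.sqrt hb) hX)
      (fun h => hX0' (congrArg Prod.snd h)) (fun h => hX0' (congrArg Prod.fst h))
      ((liftedInner_zero_left g X _).trans (map_zero _))
      (by rw [hb]; exact hRiem)
      (contDiffAt_prolongFrame (contDiffAt_leftFrame hx) 0)
      (isInvertible_prolongFrame (isInvertible_leftFrame hx) 0)
      ((eventually_mem_tangent_target hx 0).mono fun q hq η =>
        energyInChart_verticalLiftMetric g φ X η.1 η.2 hq q.2)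
      (prolongFrame_bracket (contDiffAt_leftFrame hx) (by
        filter_upwards [(isOpen_extChartAt_target p₀.proj).mem_nhds hx] with x' hx' w η
        exact leftFrame_bracket hx' w η) 0)
      ⟨Γ (x, 0), hΓ (x, 0) ((mem_extChartAt_tangent_target p₀ x 0).2 hx)⟩
  refine ⟨fun Y Z => ?_, fun Y => ?_⟩
  · have h3 : modelInner g X (modelBracket E G Y Z + modelBracket E G 0 0) = 0 :=
      (liftedInner_zero_left g X _).symm.trans (h1 ((Y : E), (0 : E)) ((0 : E), (Z : E)))
    rw [modelBracket_zero_left, add_zero] at h3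
    exact h3
  · refine eq_of_forall_inner_eq (W := E) (B := modelInner g) (modelInner_pos g) fun ζ => ?_
    have aux : ∀ X Y : E, liftedInner g (liftedBracket E G (0, X) (Y, 0)) (0, ζ) +
        liftedInner g (liftedBracket E G (0, X) (0, ζ)) (Y, 0) = 0 →
        modelInner g (modelBracket E G X Y) ζ = modelInner g 0 ζ := by
      intro X Y h
      simpa [liftedBracket, modelBracket_zero_left, modelBracket_zero_right,
        liftedInner_zero_left] using h
    -- In the Killing equation tested on `Y^c` and `ζ^v` the second term vanishes, as `[X^v, ζ^v] =
    -- 0`.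
    exact aux X Y (h2 ((Y : E), (0 : E)) ((0 : E), (ζ : E)))

/-- This is the closedness half of parallelism, now on `G`. The isotropy lemma needs a nonzero
vector orthogonal to `X`; if there is none, `X` spans the Lie algebra and all brackets vanish. -/
theorem inner_bracket_eq_zero_of_isBerwald_baseMetric (hg : IsLeftInvariant g)
    (hφ : IsAlphaBetaFunction φ b₀) (hX : √(g.inner 1 X X) < b₀) (hX0 : X ≠ 0)
    (hRiem : ¬ ∃ c₁ c₂ : ℝ, ∀ s : ℝ, |s| ≤ √(g.inner 1 X X) → φ s ^ 2 = c₁ + c₂ * s ^ 2)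
    (h : IsBerwald 𝓘(ℝ, E) (baseMetric φ g X)) (Y Z : GroupLieAlgebra 𝓘(ℝ, E) G) :
    g.inner 1 X ⁅Y, Z⁆ = 0 := by
  by_cases hf : ∃ f : E, f ≠ 0 ∧ modelInner g X f = 0
  · obtain ⟨f, hf, hXf⟩ := hf
    obtain ⟨Γ, hΓ⟩ := h 1
    obtain ⟨x, hx⟩ : ∃ x, x ∈ (extChartAt 𝓘(ℝ, E) (1 : G)).target := ⟨_, mem_extChartAt_target _⟩
    have h1 := (parallel_of_exists_sprayCoefficients_eq (W := E) (B := modelInner g)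
      (X := X) (c := modelBracket E G) (e := leftFrame (1 : G))
      (x := x) (L := energyInChart 𝓘(ℝ, E) (baseMetric φ g X) (1 : G)) (f := f)
      (modelInner_symm g) (modelInner_pos g) hφ hX hX0 hf hXf hRiem
      ((contDiffAt_leftFrame hx).of_le two_le_infty) (isInvertible_leftFrame hx)
      (by
        filter_upwards [(isOpen_extChartAt_target (1 : G)).mem_nhds hx] with x' hx' η
        exact energyInChart_baseMetric hg φ X η hx')
      (fun w η => leftFrame_bracket hx w η) ⟨Γ x, hΓ x hx⟩).1
    exact h1 Y Z
  · push Not at hf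
    let X' : E := X
    have hXX := (modelInner_pos g X hX0).ne'
    have hall : ∀ Y : E, Y = (modelInner g X Y / modelInner g X X) • X' := by
      intro Y
      by_contra hne
      refine hf (Y - (modelInner g X Y / modelInner g X X) • X') (sub_ne_zero.2 hne) ?_
      change modelInner g X' _ = 0
      rw [map_sub, map_smul, smul_eq_mul]
      exact sub_eq_zero.2 (div_mul_cancel₀ (modelInner g X Y) hXX).symm
    have h1 : ⁅Y, Z⁆ = 0 := by
      have h2 := bracket_smul_smul (modelInner g X Y / modelInner g X X)
        (modelInner g X Z / modelInner g X X) X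
      refine Eq.trans ?_ h2
      exact congrArg₂ (modelBracket E G) (hall Y) (hall Z)
    rw [h1]; exact map_zero _

theorem isBerwald_verticalLiftMetric_iff (hφ : IsAlphaBetaFunction φ b₀)
    (hX : √(g.inner 1 X X) < b₀)
    (hRiem : X ≠ 0 → ¬ ∃ c₁ c₂ : ℝ, ∀ s : ℝ, |s| ≤ √(g.inner 1 X X) → φ s ^ 2 = c₁ + c₂ * s ^ 2) :
    IsBerwald 𝓘(ℝ, E).tangent (verticalLiftMetric φ g X) ↔
      (∀ Y Z : GroupLieAlgebra 𝓘(ℝ, E) G, g.inner 1 X ⁅Y, Z⁆ = 0) ∧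
        ∀ Y : GroupLieAlgebra 𝓘(ℝ, E) G, ⁅X, Y⁆ = 0 := by
  refine ⟨fun h => ?_, fun h => isBerwald_verticalLiftMetric_of_central hφ hX h.1 h.2⟩
  by_cases hX0 : X = 0
  · subst hX0
    exact ⟨fun Y Z => by rw [map_zero]; rfl, zero_bracket⟩
  · exact central_of_isBerwald_verticalLiftMetric hφ hX hX0 (hRiem hX0) h

end Berwald

/-! ### The conditions on `ad*_X` and `∇_X` -/

section LeviCivita

variable {E : Type*} [NormedAddCommGroup E] [NormedSpace ℝ E] [FiniteDimensional ℝ E]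
  {G : Type*} [TopologicalSpace G] [ChartedSpace E G] [Group G] [LieGroup 𝓘(ℝ, E) ∞ G]
  {g : RiemannianMetricOn E G}

omit [FiniteDimensional ℝ E] in
theorem derivInner_mulInvariantVectorField (hg : IsLeftInvariant g)
    (X Y Z : GroupLieAlgebra 𝓘(ℝ, E) G) (x : G) :
    derivInner g (mulInvariantVectorField X) (mulInvariantVectorField Y)
      (mulInvariantVectorField Z) x = 0 := by
  unfold derivInner
  have : (fun a : G => g.inner a (mulInvariantVectorField Y a) (mulInvariantVectorField Z a)) =
      fun _ => g.inner 1 Y Z := funext fun a => inner_mulInvariantVectorField hg a Y Z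
  rw [this, mfderiv_const]
  rfl

theorem koszul_mulInvariantVectorField (hg : IsLeftInvariant g)
    (X Y Z : GroupLieAlgebra 𝓘(ℝ, E) G) (x : G) :
    koszul g (mulInvariantVectorField X) (mulInvariantVectorField Y)
      (mulInvariantVectorField Z) x =
      g.inner 1 ⁅X, Y⁆ Z - g.inner 1 ⁅Y, Z⁆ X + g.inner 1 ⁅Z, X⁆ Y := by
  have := lieGroup_minSmoothness E G
  have : CompleteSpace E := FiniteDimensional.complete ℝ E
  have hb : ∀ Y Z : GroupLieAlgebra 𝓘(ℝ, E) G, VectorField.mlieBracket 𝓘(ℝ, E)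
      (mulInvariantVectorField Y) (mulInvariantVectorField Z) = mulInvariantVectorField ⁅Y, Z⁆ :=
    fun Y Z => (mulInvariantVector_mlieBracket Y Z).symm
  unfold koszul
  simp only [derivInner_mulInvariantVectorField hg, hb, inner_mulInvariantVectorField hg]
  ring

theorem inner_adStar (X Y Z : GroupLieAlgebra 𝓘(ℝ, E) G) :
    g.inner 1 (adStar g X Y) Z = g.inner 1 Y ⁅X, Z⁆ := by
  have := lieGroup_minSmoothness E G
  have : CompleteSpace E := FiniteDimensional.complete ℝ E
  exact dualVector_spec g 1
    { toFun := fun Z : GroupLieAlgebra 𝓘(ℝ, E) G => g.inner 1 Y ⁅X, Z⁆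
      map_add' := fun Z Z' => by rw [lie_add]; exact map_add _ _ _
      map_smul' := fun a Z => by rw [lie_smul]; exact map_smul _ _ _ } Z

theorem inner_leviCivita_mulInvariantVectorField (hg : IsLeftInvariant g)
    (X Y Z : GroupLieAlgebra 𝓘(ℝ, E) G) (x : G) :
    g.inner x (leviCivita g (mulInvariantVectorField X) (mulInvariantVectorField Y) x)
        (mulInvariantVectorField Z x) =
      (1 / 2 : ℝ) * (g.inner 1 ⁅X, Y⁆ Z - g.inner 1 ⁅Y, Z⁆ X + g.inner 1 ⁅Z, X⁆ Y) := by
  have := lieGroup_minSmoothness E G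
  have : CompleteSpace E := FiniteDimensional.complete ℝ E
  let X' : E := X
  let Y' : E := Y
  -- `dualVector_spec` asks for a linear functional: the Koszul expression on the Lie algebra,
  -- composed below with the inverse `t` of the left translation.
  let l₀ : E →ₗ[ℝ] ℝ :=
    { toFun := fun Z : E => (1 / 2 : ℝ) * (modelInner g (modelBracket E G X' Y') Z -
        modelInner g (modelBracket E G Y' Z) X' + modelInner g (modelBracket E G Z X') Y')
      map_add' := fun Z Z' => by
        have e1 : modelBracket E G Y' (Z + Z') = modelBracket E G Y' Z + modelBracket E G Y' Z' :=
          lie_add (L := GroupLieAlgebra 𝓘(ℝ, E) G) (M := GroupLieAlgebra 𝓘(ℝ, E) G) Y Z Z'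
        have e2 : modelBracket E G (Z + Z') X' = modelBracket E G Z X' + modelBracket E G Z' X' :=
          add_lie (L := GroupLieAlgebra 𝓘(ℝ, E) G) (M := GroupLieAlgebra 𝓘(ℝ, E) G) Z Z' X
        rw [e1, e2]
        simp only [map_add, add_apply]
        ring
      map_smul' := fun a Z => by
        have e1 : modelBracket E G Y' (a • Z) = a • modelBracket E G Y' Z :=
          lie_smul (L := GroupLieAlgebra 𝓘(ℝ, E) G) (M := GroupLieAlgebra 𝓘(ℝ, E) G) a Y Z
        have e2 : modelBracket E G (a • Z) X' = a • modelBracket E G Z X' :=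
          smul_lie (L := GroupLieAlgebra 𝓘(ℝ, E) G) (M := GroupLieAlgebra 𝓘(ℝ, E) G) a Z X'
        rw [e1, e2]
        simp only [map_smul, smul_apply, smul_eq_mul, RingHom.id_apply]
        ring }
  let t : TangentSpace 𝓘(ℝ, E) x →ₗ[ℝ] E :=
    (mfderiv 𝓘(ℝ, E) 𝓘(ℝ, E) (x * ·) (1 : G)).inverse.toLinearMap
  have h1 : leviCivita g (mulInvariantVectorField X) (mulInvariantVectorField Y) x =
      dualVector g x (l₀ ∘ₗ t) := by
    unfold leviCivita
    congr 1
    funext z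
    rw [koszul_mulInvariantVectorField hg]
    rfl
  rw [h1, dualVector_spec]
  change l₀ (toLieAlgebra x (mulInvariantVectorField Z x)) = _
  rw [toLieAlgebra_mulInvariantVectorField]
  rfl

/-- Self-adjointness of `ad_X` makes `g([X, Y], Z)` symmetric in `Y` and `Z`, while the condition on
`∇_X` identifies it up to sign with the antisymmetric `g([Y, Z], X)`. Conversely, centrality and
`g(X, [Y, Z]) = 0` annihilate every term of Koszul's formula. -/
theorem adStar_eq_and_leviCivita_eq_iff (hg : IsLeftInvariant g)
    (X : GroupLieAlgebra 𝓘(ℝ, E) G) :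
    ((∀ Y : GroupLieAlgebra 𝓘(ℝ, E) G, adStar g X Y = ⁅X, Y⁆) ∧
      ∀ Y : GroupLieAlgebra 𝓘(ℝ, E) G,
        leviCivita g (mulInvariantVectorField X) (mulInvariantVectorField Y) =
          mulInvariantVectorField ((1 / 2 : ℝ) • ⁅X, Y⁆)) ↔
    (∀ Y Z : GroupLieAlgebra 𝓘(ℝ, E) G, g.inner 1 X ⁅Y, Z⁆ = 0) ∧
      ∀ Y : GroupLieAlgebra 𝓘(ℝ, E) G, ⁅X, Y⁆ = 0 := by
  have hneg : ∀ Y Z W : GroupLieAlgebra 𝓘(ℝ, E) G, g.inner 1 ⁅Y, Z⁆ W = - g.inner 1 ⁅Z, Y⁆ W := by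
    intro Y Z W
    rw [bracket_skew Y Z, map_neg]; rfl
  have hsm : ∀ (Y Z : GroupLieAlgebra 𝓘(ℝ, E) G),
      g.inner 1 ((1 / 2 : ℝ) • Y) Z = (1 / 2 : ℝ) * g.inner 1 Y Z := by
    intro Y Z; rw [map_smul]; rfl
  have hext : ∀ Y Z : GroupLieAlgebra 𝓘(ℝ, E) G, (∀ W, g.inner 1 Y W = g.inner 1 Z W) → Y = Z :=
    fun Y Z h => eq_of_forall_inner_eq (W := E) (B := modelInner g) (modelInner_pos g) h
  constructor
  · rintro ⟨h1, h2⟩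
    have ha : ∀ Y Z, g.inner 1 ⁅X, Y⁆ Z = g.inner 1 ⁅X, Z⁆ Y := by
      intro Y Z
      rw [← h1 Y, inner_adStar, g.symm]
    -- In `∇_X Y = ½[X, Y]` the first Koszul term cancels, and the other two must balance.
    have hb : ∀ Y Z, g.inner 1 ⁅Y, Z⁆ X = - g.inner 1 ⁅X, Z⁆ Y := by
      intro Y Z
      have h3 := inner_leviCivita_mulInvariantVectorField hg X Y Z 1
      rw [h2 Y, inner_mulInvariantVectorField hg, hsm, hneg Z X] at h3
      linarith
    have hc : ∀ Y Z, g.inner 1 ⁅X, Z⁆ Y = 0 := by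
      intro Y Z
      have := hb Y Z
      have := hb Z Y
      have := hneg Y Z X
      have := ha Y Z
      linarith
    refine ⟨fun Y Z => ?_, fun Y => hext _ _ fun W => ?_⟩
    · rw [g.symm, hb, hc, neg_zero]
    · rw [hc, map_zero]; rfl
  · rintro ⟨h1, h2⟩
    refine ⟨fun Y => hext _ _ fun W => ?_, fun Y => funext fun x => ?_⟩
    · rw [inner_adStar, h2, h2, map_zero, map_zero]; rfl
    · rw [h2, smul_zero]
      have hpos : ∀ v : TangentSpace 𝓘(ℝ, E) x, (∀ Z : GroupLieAlgebra 𝓘(ℝ, E) G,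
          g.inner x v (mulInvariantVectorField Z x) = 0) → v = 0 := by
        intro v hv
        by_contra hne
        have h3 := g.pos x v hne
        have h4 := hv (toLieAlgebra x v)
        rw [mulInvariantVectorField_toLieAlgebra] at h4
        exact h3.ne' h4
      refine (hpos _ fun Z => ?_).trans (map_zero _).symm
      rw [inner_leviCivita_mulInvariantVectorField hg, hneg Z X, h2, h2, g.symm _ _ X, h1]
      simp

end LeviCivita

end LiftedFinsler

end

/-! ### The main theorem -/

theorem mainTheorem3 {E : Type*} [NormedAddCommGroup E] [NormedSpace ℝ E] [FiniteDimensional ℝ E]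
    {G : Type*} [TopologicalSpace G] [ChartedSpace E G] [Group G] [LieGroup 𝓘(ℝ, E) ∞ G]
    (g : LiftedFinsler.RiemannianMetricOn E G) (hg : LiftedFinsler.IsLeftInvariant g)
    (φ : ℝ → ℝ) (b₀ : ℝ) (hφ : LiftedFinsler.IsAlphaBetaFunction φ b₀)
    (X : GroupLieAlgebra 𝓘(ℝ, E) G) (hX : √(g.inner 1 X X) < b₀)
    (hRiem : X ≠ 0 → ¬ ∃ c₁ c₂ : ℝ, ∀ s : ℝ, |s| ≤ √(g.inner 1 X X) → φ s ^ 2 = c₁ + c₂ * s ^ 2) :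
    (LiftedFinsler.IsBerwald 𝓘(ℝ, E).tangent (LiftedFinsler.verticalLiftMetric φ g X) ↔
      (∀ Y : GroupLieAlgebra 𝓘(ℝ, E) G, LiftedFinsler.adStar g X Y = ⁅X, Y⁆) ∧
        ∀ Y : GroupLieAlgebra 𝓘(ℝ, E) G,
          LiftedFinsler.leviCivita g (mulInvariantVectorField X) (mulInvariantVectorField Y) =
            mulInvariantVectorField ((1 / 2 : ℝ) • ⁅X, Y⁆)) ∧
    (LiftedFinsler.IsBerwald 𝓘(ℝ, E) (LiftedFinsler.baseMetric φ g X) →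
      (LiftedFinsler.IsBerwald 𝓘(ℝ, E).tangent (LiftedFinsler.verticalLiftMetric φ g X) ↔
        ∀ Y : GroupLieAlgebra 𝓘(ℝ, E) G, ⁅X, Y⁆ = 0)) := by
  have hiff := LiftedFinsler.isBerwald_verticalLiftMetric_iff hφ hX hRiem
  refine ⟨hiff.trans (LiftedFinsler.adStar_eq_and_leviCivita_eq_iff hg X).symm,
    fun hF => hiff.trans ⟨fun h => h.2, fun h => ⟨fun Y Z => ?_, h⟩⟩⟩
  by_cases hX0 : X = 0
  · subst hX0
    rw [map_zero]
    rfl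
  · exact LiftedFinsler.inner_bracket_eq_zero_of_isBerwald_baseMetric hg hφ hX hX0 (hRiem hX0) hF Y Z
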